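/- Let $A$ be a finite alphabet and let $L \subseteq A^+$ be a language not containing the empty word. The following are equivalent. 1. There are a finite alphabet $\Gamma$, a synchronized (automatic) rational graph $G$ labelled by $A$ with vertices in $\Gamma^*$ and of finite out-degree, a vertex $i\in\Gamma^*$ and a rational set $F\subseteq\Gamma^*$ such that $L$ is the set of labels of paths of $G$ from $i$ to a vertex of $F$. 2. $L$ is accepted by a nondeterministic linearly bounded machine with a linear number of head reversals, i.e. there are such a machine $M$ with language $L$ and a constant $c$ such that every $w\in L$ has an accepting computation of $M$ with at most $c|w|$ head reversals. 3. $L$ is recognized by a tiling system with pictures of height linear in their width, i.e. there are a tiling system $S$ with language $L$ and a constant $c$ such that every $w\in L$ is the first row of some picture of $S$ with $n$ rows and $m$ columns, $n\le cm$. Here a synchronized rational graph is given by finite transducers $(T_a)_{a\in A}$ over $\Gamma$, with labels in $(\Gamma\cup\{\varepsilon\})\times(\Gamma\cup\{\varepsilon\})$, such that along every path from the initial state of $T_a$ the labels form a block in $\Gamma\times\Gamma$ followed by a block in which all inputs, or all outputs, are $\varepsilon$; there is an edge $u \xrightarrow{a} v$ iff $(u,v)$ is accepted by $T_a$. Finite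 out-degree means that each vertex is the source of finitely many edges. A linearly bounded machine is a nondeterministic one-tape Turing machine that works, on input $w$, on $k|w|$ cells (for a constant $k\ge1$ depending on the machine), initially containing $w$ followed by blanks, between two end markers that it may scan but neither rewrite nor cross; it accepts when it reaches an accepting state; a head reversal is a change of direction of the head. A tiling system consists of a finite alphabet $\Gamma\supseteq A$, a frame symbol $\#\notin\Gamma$ and a set $\Delta$ of $2\times2$ tiles over $\Gamma\cup\{\#\}$; its pictures are the nonempty rectangular arrays over $\Gamma$ such that, after surrounding them with a frame of $\#$, every $2\times2$ block belongs to $\Delta$, and its language is the set of those first rows of its pictures that are words over $A$. -/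

import Mathlib

namespace SyncGraph

/-! ### Word transducers -/

/-- A finite transducer over the alphabet `Γ`: a finite automaton with one initial state whose
labels are pairs in `(Γ ∪ {ε}) × (Γ ∪ {ε})`, where `none` stands for `ε`. -/
structure Transducer (Γ : Type) where
  State : Type
  finite_state : Finite State
  start : State
  final : Set State
  trans : State → Option Γ × Option Γ → State → Prop

namespace Transducer

variable {Γ : Type}

/-- `T.Run p ls q`: there is a path of `T` from `p` to `q` with sequence of labels `ls`. -/
inductive Run (T : Transducer Γ) : T.State → List (Option Γ × Option Γ) → T.State → Prop
  | nil (p : T.State) : Run T p [] p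
  | cons {p q r : T.State} {l : Option Γ × Option Γ} {ls : List (Option Γ × Option Γ)} :
      T.trans p l q → Run T q ls r → Run T p (l :: ls) r

/-- The relation accepted by `T`: the pairs of words obtained by multiplying (in the monoid
`Γ* × Γ*`) the labels of a path from the initial state to a final state. -/
def Rel (T : Transducer Γ) (u v : List Γ) : Prop :=
  ∃ ls, ∃ q ∈ T.final, T.Run T.start ls q ∧
    ls.filterMap Prod.fst = u ∧ ls.filterMap Prod.snd = v

/-- `T` is (left-)synchronized: along every path from the initial state, the labels consist of a
block of labels in `Γ × Γ`, followed by a block of labels all of whose inputs are `ε` or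
all of whose outputs are `ε`. -/
def IsSynchronized (T : Transducer Γ) : Prop :=
  ∀ ls q, T.Run T.start ls q → ∃ ls₁ ls₂, ls = ls₁ ++ ls₂ ∧
    (∀ l ∈ ls₁, l.1 ≠ none ∧ l.2 ≠ none) ∧
    ((∀ l ∈ ls₂, l.1 = none) ∨ (∀ l ∈ ls₂, l.2 = none))

end Transducer

/-! ### Rational graphs and their path languages -/

/-- A rational graph labelled by `A` with vertices in `Γ*`, given by one transducer per label. -/
structure RationalGraph (A : Type*) (Γ : Type) where
  transducer : A → Transducer Γ

namespace RationalGraph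

variable {A : Type*} {Γ : Type}

/-- The graph has an edge labelled `a` from `u` to `v`. -/
def Edge (G : RationalGraph A Γ) (u : List Γ) (a : A) (v : List Γ) : Prop :=
  (G.transducer a).Rel u v

/-- All defining transducers are synchronized: `G` is a synchronized (automatic) graph. -/
def IsSynchronized (G : RationalGraph A Γ) : Prop :=
  ∀ a, (G.transducer a).IsSynchronized

/-- Every vertex is the source of finitely many edges. -/
def FiniteOutDegree (G : RationalGraph A Γ) : Prop :=
  ∀ u, {e : A × List Γ | G.Edge u e.1 e.2}.Finite

/-- `G.Path u w v`: there is a path from `u` to `v` in `G` with label `w`. -/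
inductive Path (G : RationalGraph A Γ) : List Γ → List A → List Γ → Prop
  | nil (u : List Γ) : Path G u [] u
  | cons {u v t : List Γ} {a : A} {w : List A} :
      G.Edge u a v → Path G v w t → Path G u (a :: w) t

/-- The path language `L(G, I, F)` of `G` between the sets of vertices `I` and `F`. -/
def pathLanguage (G : RationalGraph A Γ) (I F : Set (List Γ)) : Language A :=
  {w | ∃ s ∈ I, ∃ t ∈ F, G.Path s w t}

end RationalGraph

/-- `L` is accepted by a synchronized graph of finite out-degree, from a unique initial vertex to
a rational set of final vertices. -/
def AcceptedBySynchronizedGraph {A : Type*} (L : Language A) : Prop :=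
  ∃ (Γ : Type) (_ : Finite Γ) (G : RationalGraph A Γ) (i : List Γ) (F : Language Γ),
    G.IsSynchronized ∧ G.FiniteOutDegree ∧ F.IsRegular ∧ G.pathLanguage {i} F = L

/-! ### Linearly bounded machines -/

/-- The contents of a tape cell: an end marker or a letter of the tape alphabet. -/
inductive Cell (Γ : Type) where
  | leftEnd : Cell Γ
  | rightEnd : Cell Γ
  | letter (x : Γ) : Cell Γ

/-- The moves of the head. -/
inductive Move where
  | left : Move
  | stay : Move
  | right : Move
  deriving DecidableEq

/-- A nondeterministic linearly bounded machine with input alphabet `A`: a one-tape machine that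
works on a tape portion delimited by two end markers, the number of cells of which is
`(1 + extra) * |w|` on input `w`. The end markers are neither erased, nor written elsewhere, nor
crossed. -/
structure LBM (A : Type*) where
  State : Type
  finite_state : Finite State
  Symbol : Type
  finite_symbol : Finite Symbol
  input : A ↪ Symbol
  blank : Symbol
  blank_not_input : ∀ a, input a ≠ blank
  extra : ℕ
  start : State
  accept : Set State
  /-- `trans p x q y d`: in state `p` and reading `x`, the machine may write `y`, make the move
  `d` and enter the state `q`. -/
  trans : State → Cell Symbol → State → Cell Symbol → Move → Prop
  trans_leftEnd : ∀ p q y d, trans p .leftEnd q y d → y = .leftEnd ∧ d ≠ .left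
  trans_rightEnd : ∀ p q y d, trans p .rightEnd q y d → y = .rightEnd ∧ d ≠ .right
  trans_letter : ∀ p x q y d, trans p (.letter x) q y d → ∃ z, y = .letter z

namespace LBM

variable {A : Type*}

/-- A configuration: the state, the position of the head and the contents of the tape (end
markers included, at positions `0` and `tape.length - 1`). -/
structure Config (M : LBM A) where
  state : M.State
  head : ℕ
  tape : List (Cell M.Symbol)

/-- The initial configuration on input `w`: the head scans the cell to the right of the left end
marker, the tape contains `w` followed by `extra * |w|` blanks, between end markers. -/
def init (M : LBM A) (w : List A) : M.Config where
  state := M.start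
  head := 1
  tape := [Cell.leftEnd] ++
    (w.map M.input ++ List.replicate (M.extra * w.length) M.blank).map Cell.letter ++
    [Cell.rightEnd]

/-- The position of the head after a move. -/
def moveHead (i : ℕ) : Move → ℕ
  | .left => i - 1
  | .stay => i
  | .right => i + 1

/-- `M.Step c d c'`: `M` can pass from `c` to `c'` in one step, with head move `d`. -/
def Step (M : LBM A) (c : M.Config) (d : Move) (c' : M.Config) : Prop :=
  ∃ x y, c.tape[c.head]? = some x ∧ M.trans c.state x c'.state y d ∧
    c'.head = moveHead c.head d ∧ c'.tape = c.tape.set c.head y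

/-- `M.Run c ds c'`: there is a computation from `c` to `c'` with sequence of head moves `ds`. -/
inductive Run (M : LBM A) : M.Config → List Move → M.Config → Prop
  | nil (c : M.Config) : Run M c [] c
  | cons {c c' c'' : M.Config} {d : Move} {ds : List Move} :
      M.Step c d c' → Run M c' ds c'' → Run M c (d :: ds) c''

/-- The number of positions at which two consecutive entries of a list differ. -/
def changes : List Move → ℕ
  | a :: b :: ds => (if a = b then 0 else 1) + changes (b :: ds)
  | _ => 0

/-- The number of head reversals in a sequence of moves: the number of changes of direction in
the sequence of its nonstationary moves. -/
def reversals (ds : List Move) : ℕ :=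
  changes (ds.filter (fun d => d ≠ .stay))

/-- `ds` is the sequence of moves of some accepting computation of `M` on `w`. -/
def AcceptsVia (M : LBM A) (w : List A) (ds : List Move) : Prop :=
  ∃ c, M.Run (M.init w) ds c ∧ c.state ∈ M.accept

/-- The language accepted by `M`. -/
def language (M : LBM A) : Language A :=
  {w | ∃ ds, M.AcceptsVia w ds}

/-- `M` works in `f(n)` head reversals: every accepted word of length `n` has an accepting
computation with at most `f n` head reversals. -/
def WorksInReversals (M : LBM A) (f : ℕ → ℕ) : Prop :=
  ∀ w ∈ M.language, ∃ ds, M.AcceptsVia w ds ∧ reversals ds ≤ f w.length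

end LBM

/-- `L` is accepted by a nondeterministic linearly bounded machine with a linear number of head
reversals. -/
def AcceptedByLinearReversalLBM {A : Type*} (L : Language A) : Prop :=
  ∃ (M : LBM A) (c : ℕ), M.WorksInReversals (fun n => c * n) ∧ M.language = L

/-! ### Tiling systems -/

/-- A `(n, m)`-picture: a two-dimensional array with `n` rows and `m` columns. -/
abbrev Picture (Γ : Type) (n m : ℕ) := Fin n → Fin m → Γ

/-- A tile: a `(2, 2)`-picture. -/
structure Tile (Γ : Type) where
  topLeft : Γ
  topRight : Γ
  bottomLeft : Γ
  bottomRight : Γ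

/-- A tiling system with input alphabet `A`: a finite alphabet `Γ` containing `A`, and a set
of tiles over `Γ ∪ {#}`, where the frame symbol `#` is `none`. -/
structure TilingSystem (A : Type*) where
  Γ : Type
  finite_Γ : Finite Γ
  input : A ↪ Γ
  tiles : Set (Tile (Option Γ))

namespace Picture

variable {Γ : Type} {n m : ℕ}

/-- The picture `p` surrounded by a frame of `#`: rows are numbered from `0` to `n + 1` and columns
from `0` to `m + 1`, and the entry `(i + 1, j + 1)` is `p i j`. -/
def framed (p : Picture Γ n m) (i j : ℕ) : Option Γ :=
  if h : (1 ≤ i ∧ i ≤ n) ∧ (1 ≤ j ∧ j ≤ m) then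
    some (p ⟨i - 1, by omega⟩ ⟨j - 1, by omega⟩)
  else none

/-- The set of tiles that appear in the framed picture. -/
def framedTiles (p : Picture Γ n m) : Set (Tile (Option Γ)) :=
  {t | ∃ i j, i ≤ n ∧ j ≤ m ∧
    t = ⟨framed p i j, framed p i (j + 1), framed p (i + 1) j, framed p (i + 1) (j + 1)⟩}

/-- The frontier: the word in the first row of a picture with at least one row. -/
def frontier (p : Picture Γ n m) (hn : 0 < n) : List Γ :=
  List.ofFn (p ⟨0, hn⟩)

end Picture

namespace TilingSystem

variable {A : Type*}

/-- `S` has a picture of height `n` and width `m` with frontier `w`. Pictures are nonempty. -/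
def HasPicture (S : TilingSystem A) (w : List A) (n m : ℕ) : Prop :=
  ∃ (hn : 0 < n) (_ : 0 < m) (p : Picture S.Γ n m),
    Picture.framedTiles p ⊆ S.tiles ∧ Picture.frontier p hn = w.map S.input

/-- The word language of `S`: the frontiers of its pictures that are words over the input
alphabet. -/
def language (S : TilingSystem A) : Language A :=
  {w | ∃ n m, S.HasPicture w n m}

/-- `S` recognizes its language in height `f`. -/
def WorksInHeight (S : TilingSystem A) (f : ℕ → ℕ) : Prop :=
  ∀ w ∈ S.language, ∃ n m, S.HasPicture w n m ∧ n ≤ f m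

end TilingSystem

/-- `L` is recognized by a tiling system with pictures of height linear in their width. -/
def AcceptedByLinearHeightTiling {A : Type*} (L : Language A) : Prop :=
  ∃ (S : TilingSystem A) (c : ℕ), S.WorksInHeight (fun m => c * m) ∧ S.language = L

end SyncGraph

/-! All three models are compared with a fourth one: arrays of symbols with one column per letter of
the word, subject to conditions on border entries and on horizontally or vertically adjacent pairs
(`DominoSystem`), of height linear in the width.

Tilings. If the symbols are the `3 × 3` windows of a framed picture, tile conditions become
conditions on single symbols. Conversely dominoes are expressible by tiles, the word being added as
a first row.

Graphs. Grouping rows into blocks turns a picture of linear height into a square one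
(`AcceptedByDominoes.exists_square`). A square grows along its diagonal by hooks made of its last
row and last column; the compatibility of consecutive hooks is a synchronized relation that
lengthens words by one letter, and square pictures are paths of hooks (`hookGraph_path_iff`).
Conversely, the vertices of a path are laid side by side as columns, with the runs of the
transducers between them. Synchronization keeps the letters of source and target level
(`exists_padStep_of_run`), and finite out-degree bounds the growth of length along an edge
(`exists_length_le`), so the height is linear.

Machines. A machine can guess the rows of a picture, writing each over the previous one with
boundedly many reversals per row (`Accepts.exists_writer_run`, `accepts_of_writer`). Conversely,
between two reversals the head never returns to a cell that it has left, so such a sweep is a row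
with local conditions (`Sweep.exists_row`, `exists_sweep_of_row`), and a computation has one more
sweep than reversals. A tape longer than the input is folded in zigzag onto the columns of the input
(`Accepts.fold`, `accepts_of_fold`).

The empty word has no domino picture; this is where `[] ∉ L` enters. -/

namespace SyncGraph

/-! ### Domino systems -/

/-- A domino system over the alphabet `A`: local conditions on rectangular arrays of symbols the
columns of which are labelled by the letters of a word. -/
structure DominoSystem (A : Type*) where
  Symbol : Type
  finite_symbol : Finite Symbol
  top : A → Symbol → Prop
  left : Symbol → Prop
  right : Symbol → Prop
  bot : Symbol → Prop
  hor : Symbol → Symbol → Prop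
  ver : Symbol → Symbol → Prop

namespace DominoSystem

variable {A : Type*}

/-- `f` is, on rows `0, …, n` and columns `0, …, |w| - 1`, a picture of `D` below the word `w`. -/
structure IsPicture (D : DominoSystem A) (w : List A) (n : ℕ) (f : ℕ → ℕ → D.Symbol) : Prop where
  top : ∀ j (h : j < w.length), D.top w[j] (f 0 j)
  left : ∀ i ≤ n, D.left (f i 0)
  right : ∀ i ≤ n, D.right (f i (w.length - 1))
  bot : ∀ j < w.length, D.bot (f n j)
  hor : ∀ i ≤ n, ∀ j, j + 1 < w.length → D.hor (f i j) (f i (j + 1))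
  ver : ∀ i < n, ∀ j < w.length, D.ver (f i j) (f (i + 1) j)

/-- `D` has a picture with `n + 1` rows below the nonempty word `w`. -/
def Accepts (D : DominoSystem A) (w : List A) (n : ℕ) : Prop :=
  w ≠ [] ∧ ∃ f, D.IsPicture w n f

end DominoSystem

/-- `L` is recognized by a domino system with pictures of height linear in their width. -/
def AcceptedByDominoes {A : Type*} (L : Language A) : Prop :=
  ∃ (D : DominoSystem A) (c : ℕ), (∀ w n, D.Accepts w n → w ∈ L) ∧
    ∀ w ∈ L, ∃ n ≤ c * w.length, D.Accepts w n

/-- An array the entries of which satisfy `P` on a nonempty rectangle agrees there with an array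
over the subtype. -/
theorem exists_subtype_array {S : Type*} {P : S → Prop} {n m : ℕ} (hm : 0 < m) (g : ℕ → ℕ → S)
    (hg : ∀ i ≤ n, ∀ j < m, P (g i j)) :
    ∃ f : ℕ → ℕ → {s // P s}, ∀ i ≤ n, ∀ j < m, (f i j).1 = g i j := by
  classical
  -- Outside the rectangle any valid value will do; the corner `g 0 0` is one because `0 < m`.
  refine ⟨fun i j => if h : i ≤ n ∧ j < m then ⟨g i j, hg i h.1 j h.2⟩ else
    ⟨g 0 0, hg 0 (Nat.zero_le _) 0 hm⟩, fun i hi j hj => ?_⟩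
  simp [hi, hj]

/-! ### From tiling systems to domino systems -/

namespace TilingSystem

variable {A : Type*}

/-- The `(3, 3)`-windows all of whose tiles belong to `S` and whose centre is not `#`. -/
def Window (S : TilingSystem A) (g : Fin 3 → Fin 3 → Option S.Γ) : Prop :=
  (∀ a b : Fin 2, (⟨g a.castSucc b.castSucc, g a.castSucc b.succ, g a.succ b.castSucc,
    g a.succ b.succ⟩ : Tile (Option S.Γ)) ∈ S.tiles) ∧ g 1 1 ≠ none

/-- The domino system whose symbols are the windows of the framed pictures of `S`. -/
def toDomino (S : TilingSystem A) : DominoSystem A where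
  Symbol := {g // S.Window g}
  finite_symbol := by
    have := S.finite_Γ
    infer_instance
  top a s := (∀ b, s.1 0 b = none) ∧ s.1 1 1 = some (S.input a)
  left s := ∀ a, s.1 a 0 = none
  right s := ∀ a, s.1 a 2 = none
  bot s := ∀ b, s.1 2 b = none
  hor s t := ∀ a, s.1 a 1 = t.1 a 0 ∧ s.1 a 2 = t.1 a 1
  ver s t := ∀ b, s.1 1 b = t.1 0 b ∧ s.1 2 b = t.1 1 b

/-- Each entry is replaced by the window around it, the frame supplying the neighbours of border
entries. The number of rows is unchanged; `Accepts` gives the index of the last one, hence `n - 1`.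
-/
theorem toDomino_accepts (S : TilingSystem A) {w : List A} {n m : ℕ} (h : S.HasPicture w n m) :
    m = w.length ∧ S.toDomino.Accepts w (n - 1) := by
  obtain ⟨hn, hm, p, hp, hw⟩ := h
  have hlen : m = w.length := by
    have := congrArg List.length hw
    simpa [Picture.frontier] using this
  subst hlen
  refine ⟨rfl, by rintro rfl; simp at hm, ?_⟩
  obtain ⟨f, hf⟩ := exists_subtype_array (P := S.Window) (n := n - 1) hm
    (fun i j (a b : Fin 3) => p.framed (i + a) (j + b)) (by
      intro i hi j hj
      refine ⟨fun a b => hp ⟨i + a, j + b, by omega, by omega, ?_⟩, ?_⟩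
      · simp [add_assoc]
      · have : (1 ≤ i + 1 ∧ i + 1 ≤ n) ∧ (1 ≤ j + 1 ∧ j + 1 ≤ w.length) := by omega
        simp [Picture.framed, this])
  refine ⟨f, ?_, ?_, ?_, ?_, ?_, ?_⟩
  · intro j hj
    refine ⟨fun b => ?_, ?_⟩
    · rw [hf 0 (by omega) j hj]; simp [Picture.framed]
    · rw [hf 0 (by omega) j hj]
      have h2 : (1 ≤ n) ∧ (j + 1 ≤ w.length) := by omega
      have h3 := congrArg (fun l => l[j]?) hw
      simp [Picture.frontier, hj] at h3
      simp [Picture.framed, h2, h3]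
  · intro i hi a
    rw [hf i hi 0 hm]; simp [Picture.framed]
  · intro i hi a
    rw [hf i hi _ (by omega)]
    have : ¬ (w.length - 1 + 2 ≤ w.length) := by omega
    simp [Picture.framed, this]
  · intro j hj b
    rw [hf _ le_rfl j hj]
    have : ¬ (n - 1 + 2 ≤ n) := by omega
    simp [Picture.framed, this]
  · intro i hi j hj a
    rw [hf i hi j (by omega), hf i hi (j + 1) hj]
    simp [add_assoc]
  · intro i hi j hj a
    rw [hf i (by omega) j hj, hf (i + 1) (by omega) j hj]
    simp [add_assoc]

/-- The centres of the windows form the picture. Overlaps force each window to show the true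
neighbourhood of its centre (`key`), and every tile of the frame of a nonempty picture lies in the
window of some entry. -/
theorem hasPicture_of_toDomino (S : TilingSystem A) {w : List A} {n : ℕ}
    (h : S.toDomino.Accepts w n) : S.HasPicture w (n + 1) w.length := by
  obtain ⟨hw, f, hf⟩ := h
  have hm : 0 < w.length := List.length_pos_iff.2 hw
  let p : Picture S.Γ (n + 1) w.length := fun i j =>
    ((f i j).1 1 1).get (Option.isSome_iff_ne_none.2 (f i j).2.2)
  -- Agreement spreads from the centres to the middle rows of the windows by `hor`, then to whole
  -- windows by `ver`; at the border, the frame conditions take over.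
  have key : ∀ i ≤ n, ∀ j < w.length, ∀ a b : Fin 3, p.framed (i + a) (j + b) = (f i j).1 a b := by
    have h11 : ∀ i ≤ n, ∀ j < w.length, p.framed (i + 1) (j + 1) = (f i j).1 1 1 := by
      intro i hi j hj
      have : (1 ≤ i + 1 ∧ i + 1 ≤ n + 1) ∧ (1 ≤ j + 1 ∧ j + 1 ≤ w.length) := by omega
      simp [Picture.framed, this, p]
    have h1 : ∀ i ≤ n, ∀ j < w.length, ∀ b : Fin 3, p.framed (i + 1) (j + b) = (f i j).1 1 b := by
      intro i hi j hj b
      match b with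
      | 0 =>
        rcases j with _ | j
        · rw [hf.left i hi]; simp [Picture.framed]
        · rw [← (hf.hor i hi j hj 1).1, ← h11 i hi j (by omega)]; simp
      | 1 => exact h11 i hi j hj
      | 2 =>
        by_cases hj' : j + 1 < w.length
        · rw [(hf.hor i hi j hj' 1).2, ← h11 i hi _ hj']; simp [add_assoc]
        · obtain rfl : j = w.length - 1 := by omega
          rw [hf.right i hi]
          have : ¬ (w.length - 1 + 2 ≤ w.length) := by omega
          simp [Picture.framed, this]
    intro i hi j hj a b
    match a with
    | 0 =>
      rcases i with _ | i
      · rw [(hf.top j hj).1]; simp [Picture.framed]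
      · rw [← (hf.ver i hi j hj b).1, ← h1 i (by omega) j hj]; simp
    | 1 => exact h1 i hi j hj b
    | 2 =>
      by_cases hi' : i < n
      · rw [(hf.ver i hi' j hj b).2, ← h1 _ hi' j hj]; simp [add_assoc]
      · obtain rfl : i = n := by omega
        rw [hf.bot j hj]
        simp [Picture.framed]
  refine ⟨by omega, hm, p, ?_, ?_⟩
  · rintro t ⟨i, j, hi, hj, rfl⟩
    -- A tile starting in the top frame row is in the upper half of a window of the first row, any
    -- other one in the lower half of a window; similarly for columns.
    obtain ⟨i', a, hi', rfl⟩ : ∃ i', ∃ a : Fin 2, i' ≤ n ∧ i = i' + a := by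
      rcases i with _ | i
      · exact ⟨0, 0, by omega, rfl⟩
      · exact ⟨i, 1, by omega, rfl⟩
    obtain ⟨j', b, hj', rfl⟩ : ∃ j', ∃ b : Fin 2, j' < w.length ∧ j = j' + b := by
      rcases j with _ | j
      · exact ⟨0, 0, by omega, rfl⟩
      · exact ⟨j, 1, by omega, rfl⟩
    have := (f i' j').2.1 a b
    simp only [← key i' hi' j' hj'] at this
    simpa [add_assoc] using this
  · apply List.ext_getElem
    · simp [Picture.frontier]
    · intro j h1 h2
      have hj : j < w.length := by simpa using h2
      have := (hf.top j hj).2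
      simp [Picture.frontier, p, this]

end TilingSystem

theorem AcceptedByLinearHeightTiling.acceptedByDominoes {A : Type*} {L : Language A}
    (h : AcceptedByLinearHeightTiling L) : AcceptedByDominoes L := by
  obtain ⟨S, c, hS, rfl⟩ := h
  refine ⟨S.toDomino, c, fun w n h => ⟨_, _, S.hasPicture_of_toDomino h⟩, fun w hw => ?_⟩
  obtain ⟨n, m, hp, hn⟩ := hS w hw
  obtain ⟨rfl, h⟩ := S.toDomino_accepts hp
  exact ⟨n - 1, (Nat.sub_le _ _).trans hn, h⟩

/-! ### From domino systems to tiling systems -/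

namespace DominoSystem

variable {A : Type*}

/-- Horizontal dominoes of the tiling system of a domino system. -/
def TilingHor (D : DominoSystem A) {B : Type} : Option (B ⊕ D.Symbol) → Option (B ⊕ D.Symbol) → Prop
  | some (.inr s), some (.inr t) => D.hor s t
  | some (.inr s), none => D.right s
  | none, some (.inr s) => D.left s
  | some (.inl _), some (.inr _) => False
  | some (.inr _), some (.inl _) => False
  | _, _ => True

/-- Vertical dominoes of the tiling system of a domino system. -/
def TilingVer (D : DominoSystem A) {B : Type} (e : A ≃ B) :
    Option (B ⊕ D.Symbol) → Option (B ⊕ D.Symbol) → Prop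
  | none, none => True
  | none, some (.inl _) => True
  | some (.inl b), some (.inr s) => D.top (e.symm b) s
  | some (.inr s), some (.inr t) => D.ver s t
  | some (.inr s), none => D.bot s
  | _, _ => False

/-- The tiling system whose pictures are the words over `A` with a picture of `D` below. -/
noncomputable def toTiling [Finite A] (D : DominoSystem A) : TilingSystem A where
  Γ := Fin (Nat.card A) ⊕ D.Symbol
  finite_Γ := by
    have := D.finite_symbol
    infer_instance
  input := ⟨fun a => .inl (Finite.equivFin A a), fun a b h => by simpa using h⟩
  tiles := {t | D.TilingHor t.topLeft t.topRight ∧ D.TilingHor t.bottomLeft t.bottomRight ∧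
    D.TilingVer (Finite.equivFin A) t.topLeft t.bottomLeft ∧
    D.TilingVer (Finite.equivFin A) t.topRight t.bottomRight}

/-- The word is placed as an additional row above the `n + 1` rows of the domino picture. -/
theorem hasPicture_toTiling [Finite A] (D : DominoSystem A) {w : List A} {n : ℕ}
    (h : D.Accepts w n) : D.toTiling.HasPicture w (n + 2) w.length := by
  obtain ⟨hw, f, hf⟩ := h
  have hm : 0 < w.length := List.length_pos_iff.2 hw
  let p : Picture D.toTiling.Γ (n + 2) w.length := fun i j =>
    if (i : ℕ) = 0 then .inl (Finite.equivFin A w[j]) else .inr (f (i - 1) j)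
  have h0 : ∀ j, p.framed 0 j = none := by simp [Picture.framed]
  have hl : ∀ i, p.framed i 0 = none := by simp [Picture.framed]
  have hb : ∀ i j, n + 2 < i → p.framed i j = none := by
    intro i j h
    simp [Picture.framed]; omega
  have hr : ∀ i j, w.length < j → p.framed i j = none := by
    intro i j h
    simp [Picture.framed]; omega
  have h1 : ∀ j (h : j < w.length), p.framed 1 (j + 1) = some (.inl (Finite.equivFin A w[j])) := by
    intro j h
    simp [Picture.framed, h, p]
  have h2 : ∀ i ≤ n, ∀ j < w.length, p.framed (i + 2) (j + 1) = some (.inr (f i j)) := by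
    intro i hi j h
    simp [Picture.framed, h, hi, p]
  have hH : ∀ i ≤ n + 2, ∀ j ≤ w.length, D.TilingHor (p.framed i j) (p.framed i (j + 1)) := by
    intro i hi j hj
    rcases i with _ | _ | i
    · simp [h0, TilingHor]
    · rcases j with _ | j
      · simp [hl, h1 0 hm, TilingHor]
      · rw [zero_add, h1 j hj]
        by_cases hj' : j + 1 < w.length
        · simp [h1 _ hj', TilingHor]
        · rw [hr _ _ (by omega)]; simp [TilingHor]
    · have hi : i ≤ n := by omega
      rcases j with _ | j
      · rw [hl, h2 i hi 0 hm]; exact hf.left i hi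
      · rw [h2 i hi j hj]
        by_cases hj' : j + 1 < w.length
        · rw [h2 i hi _ hj']; exact hf.hor i hi j hj'
        · rw [hr _ _ (by omega)]
          obtain rfl : j = w.length - 1 := by omega
          exact hf.right i hi
  have hH' : ∀ i ≤ n + 3, ∀ j ≤ w.length, D.TilingHor (p.framed i j) (p.framed i (j + 1)) := by
    intro i hi j hj
    rcases Nat.lt_or_ge (n + 2) i with h | h
    · simp [hb i _ h, TilingHor]
    · exact hH i h j hj
  have hV : ∀ i ≤ n + 2, ∀ j ≤ w.length + 1,
      D.TilingVer (Finite.equivFin A) (p.framed i j) (p.framed (i + 1) j) := by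
    intro i hi j hj
    rcases j with _ | j
    · simp [hl, TilingVer]
    rcases Nat.lt_or_ge j w.length with hj' | hj'
    · rcases i with _ | _ | i
      · simp [h0, h1 j hj', TilingVer]
      · rw [zero_add, h1 j hj', h2 0 (Nat.zero_le _) j hj']
        simpa [TilingVer] using hf.top j hj'
      · rw [h2 i (by omega) j hj']
        by_cases hi' : i < n
        · rw [show i + 1 + 1 + 1 = (i + 1) + 2 from rfl, h2 (i + 1) hi' j hj']
          exact hf.ver i hi' j hj'
        · rw [hb _ _ (by omega)]
          obtain rfl : i = n := by omega
          exact hf.bot j hj'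
    · simp [hr _ (j + 1) (by omega), TilingVer]
  refine ⟨by omega, hm, p, ?_, ?_⟩
  · rintro t ⟨i, j, hi, hj, rfl⟩
    exact ⟨hH i hi j hj, hH' _ (by omega) j hj, hV i hi j (by omega), hV i hi _ (by omega)⟩
  · apply List.ext_getElem
    · simp [Picture.frontier]
    · intro j h1 h2
      simp only [Picture.frontier, p, toTiling, List.getElem_ofFn, List.getElem_map]
      rfl

/-- By `TilingVer`, below a letter or a symbol there can be no letter. As the frontier consists of
letters, all the other rows consist of symbols. -/
theorem accepts_of_toTiling [Finite A] (D : DominoSystem A) {w : List A} {n m : ℕ}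
    (h : D.toTiling.HasPicture w n m) : m = w.length ∧ D.Accepts w (n - 2) := by
  obtain ⟨hn, hm, p, hp, hw⟩ := h
  have hlen : m = w.length := by
    have := congrArg List.length hw
    simpa [Picture.frontier] using this
  subst hlen
  refine ⟨rfl, by rintro rfl; simp at hm, ?_⟩
  have hH : ∀ i ≤ n, ∀ j ≤ w.length, D.TilingHor (p.framed i j) (p.framed i (j + 1)) :=
    fun i hi j hj => (hp ⟨i, j, hi, hj, rfl⟩).1
  have hV : ∀ i ≤ n, ∀ j ≤ w.length,
      D.TilingVer (Finite.equivFin A) (p.framed i j) (p.framed (i + 1) j) :=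
    fun i hi j hj => (hp ⟨i, j, hi, hj, rfl⟩).2.2.1
  have hl : ∀ i, p.framed i 0 = none := by simp [Picture.framed]
  have hb : ∀ j, p.framed (n + 1) j = none := by
    intro j
    simp [Picture.framed]
  have hr : ∀ i, p.framed i (w.length + 1) = none := by
    intro i
    simp [Picture.framed]
  have h1 : ∀ j (h : j < w.length), p.framed 1 (j + 1) = some (.inl (Finite.equivFin A w[j])) := by
    intro j hj
    have h3 := congrArg (fun l => l[j]?) hw
    simp [Picture.frontier, hj] at h3
    have h2 : (1 ≤ n) ∧ (j + 1 ≤ w.length) := by omega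
    simp only [Picture.framed, le_refl, h2, Nat.le_add_left, and_self, dite_true, Nat.sub_self,
      Nat.add_sub_cancel, h3]
    rfl
  have hs : ∀ i, 1 ≤ i → i ≤ n → ∀ j < w.length, ∃ x, p.framed i (j + 1) = some x := by
    intro i hi hi' j hj
    have : (1 ≤ i ∧ i ≤ n) ∧ (1 ≤ j + 1 ∧ j + 1 ≤ w.length) := by omega
    simp [Picture.framed, this]
  -- `TilingVer` forbids the frame directly below a letter, so the row of letters is not the last
  -- one.
  have hn2 : 2 ≤ n := by
    by_contra hlt
    obtain rfl : n = 1 := by omega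
    have := hV 1 le_rfl 1 hm
    have e := h1 0 hm
    rw [zero_add] at e
    rw [e, hb] at this
    simp [TilingVer] at this
  obtain ⟨k, rfl⟩ : ∃ k, n = k + 2 := ⟨n - 2, by omega⟩
  rw [Nat.add_sub_cancel]
  have h2 : ∀ i ≤ k, ∀ j < w.length, ∃ s, p.framed (i + 2) (j + 1) = some (.inr s) := by
    intro i
    induction i with
    | zero =>
      intro _ j hj
      obtain ⟨x, hx⟩ := hs 2 (by omega) (by omega) j hj
      have := hV 1 (by omega) (j + 1) hj
      rw [h1 j hj, hx] at this
      rcases x with b | s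
      · simp [TilingVer] at this
      · exact ⟨s, hx⟩
    | succ i ih =>
      intro hi j hj
      obtain ⟨x, hx⟩ := hs (i + 1 + 2) (by omega) (by omega) j hj
      obtain ⟨s, hs⟩ := ih (by omega) j hj
      have := hV (i + 2) (by omega) (j + 1) hj
      rw [hs, show i + 2 + 1 = i + 1 + 2 from rfl, hx] at this
      rcases x with b | s
      · simp [TilingVer] at this
      · exact ⟨s, hx⟩
  obtain ⟨s₀, -⟩ := h2 0 (Nat.zero_le _) 0 hm
  have h3 : ∀ i j, ∃ s, i ≤ k → j < w.length → p.framed (i + 2) (j + 1) = some (.inr s) := by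
    intro i j
    by_cases h : i ≤ k ∧ j < w.length
    · obtain ⟨s, hs⟩ := h2 i h.1 j h.2
      exact ⟨s, fun _ _ => hs⟩
    · exact ⟨s₀, fun a b => absurd ⟨a, b⟩ h⟩
  choose f hf using h3
  refine ⟨f, ?_, ?_, ?_, ?_, ?_, ?_⟩
  · intro j hj
    have := hV 1 (by omega) (j + 1) hj
    rw [h1 j hj, hf 0 j (Nat.zero_le _) hj] at this
    simpa [TilingVer] using this
  · intro i hi
    have := hH (i + 2) (by omega) 0 (by omega)
    rw [hl, hf i 0 hi hm] at this
    exact this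
  · intro i hi
    have := hH (i + 2) (by omega) w.length le_rfl
    have e := hf i (w.length - 1) hi (by omega)
    rw [Nat.sub_add_cancel hm] at e
    rw [hr, e] at this
    exact this
  · intro j hj
    have := hV (k + 2) le_rfl (j + 1) hj
    rw [hb, hf k j le_rfl hj] at this
    exact this
  · intro i hi j hj
    have := hH (i + 2) (by omega) (j + 1) (by omega)
    rw [hf i j hi (by omega), hf i (j + 1) hi hj] at this
    exact this
  · intro i hi j hj
    have := hV (i + 2) (by omega) (j + 1) hj
    rw [hf i j (by omega) hj, show i + 2 + 1 = i + 1 + 2 from rfl, hf (i + 1) j hi hj] at this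
    exact this

end DominoSystem

theorem AcceptedByDominoes.acceptedByLinearHeightTiling {A : Type*} [Finite A] {L : Language A}
    (h : AcceptedByDominoes L) : AcceptedByLinearHeightTiling L := by
  obtain ⟨D, c, h1, h2⟩ := h
  have hL : D.toTiling.language = L := by
    ext w
    refine ⟨fun ⟨n, m, h⟩ => h1 w _ (D.accepts_of_toTiling h).2, fun hw => ?_⟩
    obtain ⟨n, -, h⟩ := h2 w hw
    exact ⟨_, _, D.hasPicture_toTiling h⟩
  -- The height is `n + 2`, and the two extra rows cost at most `2 * w.length` because the word is
  -- nonempty.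
  refine ⟨D.toTiling, c + 2, fun w hw => ?_, hL⟩
  rw [hL] at hw
  obtain ⟨n, hn, h⟩ := h2 w hw
  refine ⟨_, _, D.hasPicture_toTiling h, ?_⟩
  have := List.length_pos_iff.2 h.1
  show n + 2 ≤ (c + 2) * w.length
  nlinarith

/-! ### Square pictures -/

namespace DominoSystem

variable {A : Type*}

/-- Vertical dominoes of pictures padded below with `none`. -/
def PadVer (D : DominoSystem A) : Option D.Symbol → Option D.Symbol → Prop
  | some s, some t => D.ver s t
  | some s, none => D.bot s
  | none, none => True
  | none, some _ => False

/-- Horizontal dominoes of pictures padded below with `none`. -/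
def PadHor (D : DominoSystem A) : Option D.Symbol → Option D.Symbol → Prop
  | some s, some t => D.hor s t
  | none, none => True
  | _, _ => False

/-- The domino system whose rows are the blocks of `c + 1` rows of padded pictures of `D`. -/
def square (D : DominoSystem A) (c : ℕ) : DominoSystem A where
  Symbol := Fin (c + 1) → Option D.Symbol
  finite_symbol := by
    have := D.finite_symbol
    infer_instance
  top a s := (∃ x, s 0 = some x ∧ D.top a x) ∧ ∀ b : Fin c, D.PadVer (s b.castSucc) (s b.succ)
  left s := ∀ b x, s b = some x → D.left x
  right s := ∀ b x, s b = some x → D.right x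
  bot s := D.PadVer (s (Fin.last c)) none
  hor s t := ∀ b, D.PadHor (s b) (t b)
  ver s t := D.PadVer (s (Fin.last c)) (t 0) ∧ ∀ b : Fin c, D.PadVer (t b.castSucc) (t b.succ)

/-- As the word is nonempty, `n + 1 ≤ (c + 1) * w.length`: the picture fits into `w.length` blocks
of `c + 1` rows, and what remains is padded with `none`. -/
theorem square_accepts (D : DominoSystem A) {c n : ℕ} {w : List A} (h : D.Accepts w n)
    (hn : n ≤ c * w.length) : (D.square c).Accepts w (w.length - 1) := by
  obtain ⟨hw, f, hf⟩ := h
  have hm : 0 < w.length := List.length_pos_iff.2 hw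
  obtain ⟨g, hg⟩ : ∃ g : ℕ → ℕ → Option D.Symbol,
    ∀ i j, g i j = if i ≤ n then some (f i j) else none := ⟨_, fun _ _ => rfl⟩
  have hver : ∀ i, ∀ j < w.length, D.PadVer (g i j) (g (i + 1) j) := by
    intro i j hj
    rcases lt_trichotomy i n with h | rfl | h
    · rw [hg, hg, if_pos h.le, if_pos (Nat.succ_le_of_lt h)]; exact hf.ver i h j hj
    · rw [hg, hg, if_pos le_rfl, if_neg (by omega)]; exact hf.bot j hj
    · rw [hg, hg, if_neg (by omega), if_neg (by omega)]; trivial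
  have hsome : ∀ {i j x}, g i j = some x → i ≤ n ∧ f i j = x := by
    intro i j x h
    rw [hg] at h
    split_ifs at h with h'
    exact ⟨h', by simpa using h⟩
  refine ⟨hw, fun i j b => g ((c + 1) * i + b) j, ?_, ?_, ?_, ?_, ?_, ?_⟩
  · intro j hj
    refine ⟨⟨f 0 j, by simp [hg], hf.top j hj⟩, fun b => hver _ j hj⟩
  · intro i _ b x hx
    obtain ⟨h, rfl⟩ := hsome hx
    exact hf.left _ h
  · intro i _ b x hx
    obtain ⟨h, rfl⟩ := hsome hx
    exact hf.right _ h
  · intro j hj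
    have h := hver ((c + 1) * (w.length - 1) + c) j hj
    have e : (c + 1) * (w.length - 1) + c + 1 = (c + 1) * w.length := by
      obtain ⟨k, hk⟩ := Nat.exists_eq_add_of_lt hm
      rw [hk]; simp; ring
    rw [e, hg ((c + 1) * w.length), if_neg (by nlinarith)] at h
    exact h
  · intro i _ j hj b
    show D.PadHor (g _ _) (g _ _)
    rw [hg, hg]
    split_ifs with h
    · exact hf.hor _ h j hj
    · trivial
  · intro i hi j hj
    exact ⟨hver ((c + 1) * i + c) j hj, fun b => hver _ j hj⟩

/-- Unpacking the blocks gives a padded array. By `PadHor` a row is either entirely `none` or free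
of `none`; the rows above the first `none` row form a picture, its bottom condition being the
transition of `PadVer` to `none`. -/
theorem accepts_of_square (D : DominoSystem A) {c : ℕ} {w : List A}
    (h : (D.square c).Accepts w (w.length - 1)) : ∃ n, D.Accepts w n := by
  classical
  obtain ⟨hw, f, hf⟩ := h
  have hm : 0 < w.length := List.length_pos_iff.2 hw
  obtain ⟨g, hg⟩ : ∃ g : ℕ → ℕ → Option D.Symbol, ∀ i j, g i j =
    if i / (c + 1) < w.length then f (i / (c + 1)) j ⟨i % (c + 1), Nat.mod_lt _ (by omega)⟩
    else none := ⟨_, fun _ _ => rfl⟩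
  have hver : ∀ i, ∀ j < w.length, D.PadVer (g i j) (g (i + 1) j) := by
    intro i j hj
    obtain ⟨q, r, hr, rfl⟩ : ∃ q r, r < c + 1 ∧ i = r + (c + 1) * q :=
      ⟨i / (c + 1), i % (c + 1), Nat.mod_lt _ (by omega), (Nat.mod_add_div _ _).symm⟩
    have hd : ∀ r', r' < c + 1 → (r' + (c + 1) * q) / (c + 1) = q := fun r' h => by
      rw [Nat.add_mul_div_left _ _ (by omega), Nat.div_eq_of_lt h, zero_add]
    have hmd : ∀ r', r' < c + 1 → (r' + (c + 1) * q) % (c + 1) = r' := fun r' h => by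
      rw [Nat.add_mul_mod_self_left, Nat.mod_eq_of_lt h]
    rw [hg]
    simp only [hd r hr, hmd r hr]
    rcases Nat.lt_or_ge r c with h | h
    · rw [hg, show r + (c + 1) * q + 1 = (r + 1) + (c + 1) * q by ring]
      simp only [hd (r + 1) (by omega), hmd (r + 1) (by omega)]
      split_ifs with hq
      · have : ∀ b : Fin c, D.PadVer (f q j b.castSucc) (f q j b.succ) := by
          rcases q with _ | q
          · exact (hf.top j hj).2
          · exact (hf.ver q (by omega) j hj).2
        exact this ⟨r, h⟩
      · trivial
    · obtain rfl : r = c := by omega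
      rw [hg, show r + (r + 1) * q + 1 = (r + 1) * (q + 1) by ring]
      simp only [Nat.mul_div_cancel_left _ (Nat.succ_pos r), Nat.mul_mod_right]
      split_ifs with h1 h2
      · exact (hf.ver q (by omega) j hj).1
      · obtain rfl : q = w.length - 1 := by omega
        exact hf.bot j hj
      · omega
      · trivial
  have hhor : ∀ i j, j + 1 < w.length → D.PadHor (g i j) (g i (j + 1)) := by
    intro i j hj
    rw [hg, hg]
    split_ifs with h
    · exact hf.hor _ (by omega) j hj _
    · trivial
  have hside : ∀ i x, (g i 0 = some x → D.left x) ∧ (g i (w.length - 1) = some x → D.right x) := by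
    intro i x
    rw [hg, hg]
    split_ifs with h
    · exact ⟨hf.left _ (by omega) _ x, hf.right _ (by omega) _ x⟩
    · simp
  have htop : ∀ j (h : j < w.length), ∃ x, g 0 j = some x ∧ D.top w[j] x := by
    intro j hj
    rw [hg]
    simpa [hm] using (hf.top j hj).1
  have huni : ∀ i, ∀ j < w.length, (g i j = none ↔ g i 0 = none) := by
    intro i j
    induction j with
    | zero => simp
    | succ j ih =>
      intro hj
      rw [← ih (by omega)]
      have := hhor i j hj
      revert this
      rcases g i j with _ | s <;> rcases g i (j + 1) with _ | t <;> simp [PadHor]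
  -- All rows beyond the last block are `none`, so a first such row exists; it is not row `0`,
  -- because of the top condition.
  have hex : ∃ i, g i 0 = none := by
    refine ⟨(c + 1) * w.length, ?_⟩
    rw [hg, Nat.mul_div_cancel_left _ (Nat.succ_pos c), if_neg (lt_irrefl _)]
  obtain ⟨N, hN, hmin⟩ : ∃ N, g N 0 = none ∧ ∀ i < N, g i 0 ≠ none :=
    ⟨Nat.find hex, Nat.find_spec hex, fun i hi => Nat.find_min hex hi⟩
  obtain ⟨x₀, hx₀, -⟩ := htop 0 hm
  rcases N with _ | n
  · rw [hx₀] at hN; cases hN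
  have hsome : ∀ i j, ∃ x, i ≤ n → j < w.length → g i j = some x := by
    intro i j
    by_cases h : i ≤ n ∧ j < w.length
    · have := hmin i (by omega)
      rw [ne_eq, ← huni i j h.2, ← ne_eq, Option.ne_none_iff_exists'] at this
      obtain ⟨x, hx⟩ := this
      exact ⟨x, fun _ _ => hx⟩
    · exact ⟨x₀, fun a b => absurd ⟨a, b⟩ h⟩
  choose f' hf' using hsome
  refine ⟨n, hw, f', ?_, ?_, ?_, ?_, ?_, ?_⟩
  · intro j hj
    obtain ⟨x, hx, h⟩ := htop j hj
    rw [hf' 0 j (Nat.zero_le _) hj] at hx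
    cases hx
    exact h
  · exact fun i hi => (hside i _).1 (hf' i 0 hi hm)
  · exact fun i hi => (hside i _).2 (hf' i _ hi (by omega))
  · intro j hj
    have := hver n j hj
    rw [(huni (n + 1) j hj).2 hN, hf' n j le_rfl hj] at this
    exact this
  · intro i hi j hj
    have := hhor i j hj
    rw [hf' i j hi (by omega), hf' i _ hi hj] at this
    exact this
  · intro i hi j hj
    have := hver i j hj
    rw [hf' i j (by omega) hj, hf' _ j hi hj] at this
    exact this

end DominoSystem

/-- With as many rows as columns, a picture can grow along its diagonal, one letter of the word at a
time. -/
theorem AcceptedByDominoes.exists_square {A : Type*} {L : Language A} (h : AcceptedByDominoes L) :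
    ∃ D : DominoSystem A, ∀ w, w ∈ L ↔ D.Accepts w (w.length - 1) := by
  obtain ⟨D, c, h1, h2⟩ := h
  refine ⟨D.square c, fun w => ⟨fun hw => ?_, fun h => ?_⟩⟩
  · obtain ⟨n, hn, h⟩ := h2 w hw
    exact D.square_accepts h hn
  · obtain ⟨n, h⟩ := D.accepts_of_square h
    exact h1 w n h

/-! ### Runs of transducers, paths of graphs -/

namespace Transducer

variable {Γ : Type} (T : Transducer Γ)

theorem run_nil_iff {p q : T.State} : T.Run p [] q ↔ p = q :=
  ⟨fun h => by cases h; rfl, fun h => h ▸ .nil p⟩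

theorem run_cons_iff {p q : T.State} {l ls} :
    T.Run p (l :: ls) q ↔ ∃ r, T.trans p l r ∧ T.Run r ls q :=
  ⟨fun h => by cases h with | cons h h' => exact ⟨_, h, h'⟩, fun ⟨_, h, h'⟩ => .cons h h'⟩

end Transducer

namespace RationalGraph

variable {A : Type*} {Γ : Type}

theorem path_iff_exists_vertices (G : RationalGraph A Γ) {u v : List Γ} {w : List A} :
    G.Path u w v ↔ ∃ g : ℕ → List Γ, g 0 = u ∧ g w.length = v ∧
      ∀ k (h : k < w.length), G.Edge (g k) w[k] (g (k + 1)) := by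
  constructor
  · intro h
    induction h with
    | nil u => exact ⟨fun _ => u, rfl, rfl, by simp⟩
    | @cons u v t a w he _ ih =>
      obtain ⟨g, h0, h1, h2⟩ := ih
      refine ⟨fun k => Nat.casesOn k u g, rfl, h1, fun k hk => ?_⟩
      rcases k with _ | k
      · simpa [h0] using he
      · simpa using h2 k (by simpa using hk)
  · rintro ⟨g, rfl, rfl, h⟩
    induction w generalizing g with
    | nil => exact .nil _
    | cons a w ih =>
      refine .cons (h 0 (by simp)) ?_
      exact ih (fun k => g (k + 1)) fun k hk => h (k + 1) (by simpa using hk)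

end RationalGraph

/-! ### From domino systems to synchronized graphs -/

namespace DominoSystem

variable {A : Type*}

/-- Letters of the hooks: an entry of the last row and an entry of the last column of the upper left
square of a picture. -/
abbrev HookSymbol (D : DominoSystem A) : Type := D.Symbol × D.Symbol

/-- Two consecutive letters of a hook. -/
def HookNext (D : DominoSystem A) (a : A) : Option D.HookSymbol → D.HookSymbol → Prop
  | none, y => D.left y.1 ∧ D.top a y.2
  | some x, y => D.hor x.1 y.1 ∧ D.ver x.2 y.2

/-- Letters at the same place of two consecutive hooks. -/
def HookExtends (D : DominoSystem A) (x y : D.HookSymbol) : Prop :=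
  D.ver x.1 y.1 ∧ D.hor x.2 y.2

/-- The transducer of the successor relation of hooks. -/
def hookTransducer (D : DominoSystem A) (a : A) : Transducer D.HookSymbol where
  State := Option (Option D.HookSymbol)
  finite_state := by
    have := D.finite_symbol
    infer_instance
  start := some none
  final := {none}
  trans p l q := ∃ o y, p = some o ∧ l.2 = some y ∧ D.HookNext a o y ∧
    ((∃ x, l.1 = some x ∧ D.HookExtends x y ∧ q = some (some y)) ∨
      (l.1 = none ∧ y.1 = y.2 ∧ q = none))

/-- The graph whose vertices are the hooks. -/
def hookGraph (D : DominoSystem A) : RationalGraph A D.HookSymbol where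
  transducer := D.hookTransducer

/-- `v` is a hook extending the hook `u`, the letter before the hook `v` being `o`. -/
def HookRel (D : DominoSystem A) (a : A) :
    Option D.HookSymbol → List D.HookSymbol → List D.HookSymbol → Prop
  | o, [], [y] => D.HookNext a o y ∧ y.1 = y.2
  | o, x :: u, y :: v => D.HookNext a o y ∧ D.HookExtends x y ∧ HookRel D a (some y) u v
  | _, _, _ => False

theorem hookTransducer_run_none (D : DominoSystem A) {a : A} {ls q}
    (h : (D.hookTransducer a).Run none ls q) : ls = [] := by
  rcases ls with _ | ⟨l, ls⟩
  · rfl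
  · obtain ⟨_, ⟨o, y, h, -⟩, -⟩ := (Transducer.run_cons_iff _).1 h
    cases h

/-- The only transition without input writes the diagonal entry and enters the state `none`, which
has no outgoing transition. -/
theorem hookTransducer_isSynchronized (D : DominoSystem A) (a : A) :
    (D.hookTransducer a).IsSynchronized := by
  have key : ∀ ls o q, (D.hookTransducer a).Run (some o) ls q → ∃ ls₁ ls₂, ls = ls₁ ++ ls₂ ∧
      (∀ l ∈ ls₁, l.1 ≠ none ∧ l.2 ≠ none) ∧ (∀ l ∈ ls₂, l.1 = none) := by
    intro ls
    induction ls with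
    | nil => exact fun _ _ _ => ⟨[], [], by simp⟩
    | cons l ls ih =>
      intro o q h
      obtain ⟨_, ⟨o, y, -, hy, -, ⟨x, hx, -, rfl⟩ | ⟨hx, -, rfl⟩⟩, h'⟩ :=
        (Transducer.run_cons_iff _).1 h
      · obtain ⟨ls₁, ls₂, rfl, h1, h2⟩ := ih _ _ h'
        refine ⟨l :: ls₁, ls₂, rfl, ?_, h2⟩
        simpa [hx, hy] using h1
      · obtain rfl := D.hookTransducer_run_none h'
        exact ⟨[], [l], by simp [hx]⟩
  intro ls q h
  obtain ⟨ls₁, ls₂, h, h1, h2⟩ := key ls none q h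
  exact ⟨ls₁, ls₂, h, h1, .inl h2⟩

theorem hookTransducer_run_iff (D : DominoSystem A) (a : A) (u v : List D.HookSymbol)
    (o : Option D.HookSymbol) :
    (∃ ls, (D.hookTransducer a).Run (some o) ls none ∧ ls.filterMap Prod.fst = u ∧
      ls.filterMap Prod.snd = v) ↔ D.HookRel a o u v := by
  constructor
  · rintro ⟨ls, h, rfl, rfl⟩
    induction ls generalizing o with
    | nil =>
      cases (Transducer.run_nil_iff _).1 h
    | cons l ls ih =>
      obtain ⟨lx, ly⟩ := l
      obtain ⟨_, ⟨_, y, ⟨⟩, hy, hn, ⟨x, hx, he, rfl⟩ | ⟨hx, he, rfl⟩⟩, h'⟩ :=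
        (Transducer.run_cons_iff _).1 h
      · dsimp only at hx hy
        subst hx hy
        exact ⟨hn, he, ih _ h'⟩
      · dsimp only at hx hy
        subst hx hy
        obtain rfl := D.hookTransducer_run_none h'
        exact ⟨hn, he⟩
  · intro h
    induction u generalizing o v with
    | nil =>
      match v, h with
      | [y], h =>
        exact ⟨[(none, some y)], .cons ⟨o, y, rfl, rfl, h.1, .inr ⟨rfl, h.2, rfl⟩⟩ (.nil _),
          rfl, rfl⟩
    | cons x u ih =>
      match v, h with
      | y :: v, h =>
        obtain ⟨ls, h1, rfl, rfl⟩ := ih _ _ h.2.2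
        exact ⟨(some x, some y) :: ls,
          .cons ⟨o, y, rfl, rfl, h.1, .inl ⟨x, rfl, h.2.1, rfl⟩⟩ h1, rfl, rfl⟩

theorem hookGraph_edge_iff (D : DominoSystem A) {a : A} {u v : List D.HookSymbol} :
    D.hookGraph.Edge u a v ↔ D.HookRel a none u v := by
  rw [← hookTransducer_run_iff]
  constructor
  · rintro ⟨ls, q, rfl, h⟩
    exact ⟨ls, h⟩
  · rintro ⟨ls, h⟩
    exact ⟨ls, none, rfl, h⟩

/-- The recursive form follows the runs of the transducer; the indexed form is the one to be matched
with the entries of a picture. -/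
theorem hookRel_iff (D : DominoSystem A) {a : A} {o : Option D.HookSymbol}
    {u v : List D.HookSymbol} :
    D.HookRel a o u v ↔ v.length = u.length + 1 ∧
      (∀ y, v[0]? = some y → D.HookNext a o y) ∧
      (∀ (j : ℕ) x y, v[j]? = some x → v[j + 1]? = some y → D.HookNext a (some x) y) ∧
      (∀ (j : ℕ) x y, u[j]? = some x → v[j]? = some y → D.HookExtends x y) ∧
      (∀ y, v[u.length]? = some y → y.1 = y.2) := by
  induction u generalizing o v with
  | nil =>
    match v with
    | [] => simp [HookRel]
    | [y] => simp [HookRel]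
    | y :: z :: v => simp [HookRel]
  | cons x u ih =>
    match v with
    | [] => simp [HookRel]
    | y :: v =>
      simp only [HookRel, ih, List.length_cons, Nat.add_right_cancel_iff, List.getElem?_cons_zero,
        Option.some.injEq, forall_eq', List.getElem?_cons_succ]
      constructor
      · rintro ⟨h1, h2, h3, h4, h5, h6, h7⟩
        refine ⟨h3, h1, ?_, ?_, h7⟩
        · rintro (_ | j) x y' hx hy
          · cases hx; exact h4 _ hy
          · exact h5 _ _ _ hx hy
        · rintro (_ | j) x y' hx hy
          · cases hx; cases hy; exact h2
          · exact h6 _ _ _ hx hy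
      · rintro ⟨h1, h2, h3, h4, h5⟩
        exact ⟨h2, h4 0 _ _ rfl rfl, h1, fun y' hy => h3 0 _ _ rfl hy,
          fun j => h3 (j + 1), fun j => h4 (j + 1), h5⟩

/-- The hooks from which a picture can be completed by its frame. -/
def finalHooks (D : DominoSystem A) : Language D.HookSymbol :=
  {v | v ≠ [] ∧ ∀ y ∈ v, D.bot y.1 ∧ D.right y.2}

theorem isRegular_nonempty_forall {Γ : Type} (P : Γ → Prop) :
    Language.IsRegular ({v | v ≠ [] ∧ ∀ y ∈ v, P y} : Language Γ) := by
  classical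
  -- The two bits record whether a letter has been read and whether all letters read satisfy `P`.
  let M : DFA Γ (Bool × Bool) :=
    { step := fun s x => (true, s.2 && decide (P x)), start := (false, true),
      accept := {(true, true)} }
  have key : ∀ v s, M.evalFrom s v = (s.1 || !v.isEmpty, s.2 && decide (∀ y ∈ v, P y)) := by
    intro v
    induction v with
    | nil => simp
    | cons x v ih =>
      intro s
      rw [DFA.evalFrom_cons, ih]
      simp [M, Bool.and_assoc]
  refine ⟨_, inferInstance, M, ?_⟩
  ext v
  rw [DFA.mem_accepts, DFA.eval, key]
  show (_, _) = (_, _) ↔ (v ≠ [] ∧ ∀ y ∈ v, P y)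
  simp [M]

/-- All successors of `u` have length `u.length + 1`, over a finite alphabet. -/
theorem hookGraph_finiteOutDegree [Finite A] (D : DominoSystem A) :
    D.hookGraph.FiniteOutDegree := by
  have := D.finite_symbol
  intro u
  refine (Set.finite_univ.prod (List.finite_length_eq D.HookSymbol (u.length + 1))).subset ?_
  rintro ⟨a, v⟩ h
  rw [Set.mem_ofPred_eq, hookGraph_edge_iff, hookRel_iff] at h
  exact ⟨trivial, h.1⟩

/-- The vertex reached after `k` letters describes the border of the upper left `k × k` square: its
letter `j` pairs the entries `(k - 1, j)` and `(j, k - 1)`. `HookNext` holds the domino conditions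
along the new row and column, `HookExtends` those towards the previous hook, and the label of an
edge is the letter above the new column. -/
theorem hookGraph_path_iff (D : DominoSystem A) {w : List A} :
    w ∈ D.hookGraph.pathLanguage {[]} D.finalHooks ↔ D.Accepts w (w.length - 1) := by
  constructor
  · rintro ⟨_, rfl, t, ⟨ht, ht'⟩, h⟩
    rw [RationalGraph.path_iff_exists_vertices] at h
    obtain ⟨g, h0, rfl, hg⟩ := h
    have hw : w ≠ [] := by
      rintro rfl
      exact ht h0
    have hm : 0 < w.length := List.length_pos_iff.2 hw
    simp only [hookGraph_edge_iff, hookRel_iff] at hg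
    have hlen : ∀ k ≤ w.length, (g k).length = k := by
      intro k
      induction k with
      | zero => simp [h0]
      | succ k ih =>
        intro hk
        rw [(hg k hk).1, ih (by omega)]
    have hget : ∀ k j, ∃ y, j ≤ k → k < w.length → (g (k + 1))[j]? = some y := by
      have y₀ : D.HookSymbol := (g w.length).head ht
      intro k j
      by_cases h : j ≤ k ∧ k < w.length
      · have h' : j < (g (k + 1)).length := by rw [hlen _ h.2]; omega
        exact ⟨_, fun _ _ => List.getElem?_eq_getElem h'⟩
      · exact ⟨y₀, fun a b => absurd ⟨a, b⟩ h⟩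
    choose F hF using hget
    have hdiag : ∀ k < w.length, (F k k).1 = (F k k).2 := by
      intro k hk
      refine (hg k hk).2.2.2.2 _ ?_
      rw [hlen k hk.le]
      exact hF k k le_rfl hk
    have hnext : ∀ k (hk : k < w.length), ∀ j < k, D.HookNext w[k] (some (F k j)) (F k (j + 1)) :=
      fun k hk j hj => (hg k hk).2.2.1 j _ _ (hF k j hj.le hk) (hF k _ hj hk)
    have hext : ∀ k, k + 1 < w.length → ∀ j ≤ k, D.HookExtends (F k j) (F (k + 1) j) :=
      fun k hk j hj => (hg (k + 1) hk).2.2.2.1 j _ _ (hF k j hj (by omega))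
        (hF (k + 1) j (by omega) hk)
    have hbeg : ∀ k (hk : k < w.length), D.left (F k 0).1 ∧ D.top w[k] (F k 0).2 :=
      fun k hk => (hg k hk).2.1 _ (hF k 0 (Nat.zero_le _) hk)
    have hfin : ∀ j < w.length, D.bot (F (w.length - 1) j).1 ∧ D.right (F (w.length - 1) j).2 := by
      intro j hj
      refine ht' _ ?_
      have := hF (w.length - 1) j (by omega) (by omega)
      rw [Nat.sub_add_cancel hm] at this
      exact List.mem_of_getElem? this
    -- Entries on or below the diagonal are taken from the row part of a hook, those above it from
    -- the column part; by `hdiag` both parts agree on the diagonal.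
    refine ⟨hw, fun i j => if j ≤ i then (F i j).1 else (F j i).2, ?_, ?_, ?_, ?_, ?_, ?_⟩
    · intro j hj
      rcases j with _ | j
      · have := (hbeg 0 hj).2
        simpa [hdiag 0 hj] using this
      · simpa using (hbeg _ hj).2
    · intro i hi
      simpa using (hbeg i (by omega)).1
    · intro i hi
      have := (hfin i (by omega)).2
      split_ifs with h
      · obtain rfl : i = w.length - 1 := by omega
        rwa [hdiag _ (by omega)]
      · exact this
    · intro j hj
      have := (hfin j hj).1
      simpa [show j ≤ w.length - 1 by omega] using this
    · intro i hi j hj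
      rcases lt_trichotomy i j with h | rfl | h
      · simpa [show ¬ j ≤ i by omega, show ¬ j + 1 ≤ i by omega] using (hext j hj i h.le).2
      · simpa [hdiag i (by omega)] using (hext i hj i le_rfl).2
      · simpa [h.le, Nat.succ_le_of_lt h] using (hnext i (by omega) j h).1
    · intro i hi j hj
      rcases Nat.lt_or_ge i j with h | h
      · have := (hnext j (by omega) i h).2
        rcases Nat.lt_or_ge (i + 1) j with h' | h'
        · simpa [show ¬ j ≤ i by omega, show ¬ j ≤ i + 1 by omega] using this
        · obtain rfl : j = i + 1 := by omega
          simpa [hdiag (i + 1) hj] using this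
      · simpa [h, show j ≤ i + 1 by omega] using (hext i (by omega) j h).1
  · rintro ⟨hw, f, hf⟩
    have hm : 0 < w.length := List.length_pos_iff.2 hw
    -- For `k = 0` the list is empty, so the truncated subtraction `k - 1` does no harm.
    obtain ⟨g, hg⟩ : ∃ g : ℕ → List D.HookSymbol,
      ∀ k, g k = (List.range k).map fun j => (f (k - 1) j, f j (k - 1)) := ⟨_, fun _ => rfl⟩
    have hlen : ∀ k, (g k).length = k := fun k => by simp [hg]
    have hget : ∀ {k j y}, (g (k + 1))[j]? = some y → j ≤ k ∧ y = (f k j, f j k) := by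
      intro k j y h
      rw [hg] at h
      simp only [List.getElem?_map, Option.map_eq_some_iff, List.getElem?_eq_some_iff,
        List.length_range, List.getElem_range] at h
      obtain ⟨_, ⟨h1, rfl⟩, rfl⟩ := h
      exact ⟨by omega, rfl⟩
    refine ⟨[], rfl, g w.length, ⟨?_, ?_⟩, D.hookGraph.path_iff_exists_vertices.2
      ⟨g, by simp [hg], rfl, fun k hk => ?_⟩⟩
    · rw [← List.length_pos_iff, hlen]; exact hm
    · intro y hy
      obtain ⟨j, hj⟩ := List.mem_iff_getElem?.1 hy
      rw [← Nat.sub_add_cancel hm] at hj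
      obtain ⟨h1, rfl⟩ := hget hj
      exact ⟨hf.bot j (by omega), hf.right j (by omega)⟩
    · rw [hookGraph_edge_iff, hookRel_iff]
      refine ⟨by simp [hlen], ?_, ?_, ?_, ?_⟩
      · intro y hy
        obtain ⟨-, rfl⟩ := hget hy
        exact ⟨hf.left k (by omega), hf.top k hk⟩
      · intro j x y hx hy
        obtain ⟨-, rfl⟩ := hget hx
        obtain ⟨hj, rfl⟩ := hget hy
        exact ⟨hf.hor k (by omega) j (by omega), hf.ver j (by omega) k hk⟩
      · intro j x y hx hy
        rcases k with _ | k
        · simp [hg] at hx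
        · obtain ⟨hj, rfl⟩ := hget hx
          obtain ⟨-, rfl⟩ := hget hy
          exact ⟨hf.ver k (by omega) j (by omega), hf.hor j (by omega) k hk⟩
      · intro y hy
        rw [hlen] at hy
        obtain ⟨-, rfl⟩ := hget hy
        rfl

end DominoSystem

theorem AcceptedByDominoes.acceptedBySynchronizedGraph {A : Type*} [Finite A] {L : Language A}
    (h : AcceptedByDominoes L) : AcceptedBySynchronizedGraph L := by
  obtain ⟨D, hD⟩ := h.exists_square
  have := D.finite_symbol
  refine ⟨D.HookSymbol, inferInstance, D.hookGraph, [], D.finalHooks,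
    D.hookTransducer_isSynchronized, D.hookGraph_finiteOutDegree,
    DominoSystem.isRegular_nonempty_forall _, ?_⟩
  ext w
  rw [D.hookGraph_path_iff, hD]

/-! ### From synchronized graphs to domino systems -/

namespace Transducer

variable {Γ : Type} (T : Transducer Γ)

theorem run_append_iff {p q : T.State} {l₁ l₂} :
    T.Run p (l₁ ++ l₂) q ↔ ∃ r, T.Run p l₁ r ∧ T.Run r l₂ q := by
  induction l₁ generalizing p with
  | nil => simp [run_nil_iff]
  | cons l l₁ ih =>
    simp only [List.cons_append, run_cons_iff, ih]
    constructor
    · rintro ⟨a, h, b, h', h''⟩; exact ⟨b, ⟨a, h, h'⟩, h''⟩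
    · rintro ⟨b, ⟨a, h, h'⟩, h''⟩; exact ⟨a, h, b, h', h''⟩

/-- Paths labelled `ε`. -/
def Eps : T.State → T.State → Prop :=
  Relation.ReflTransGen fun p q => T.trans p (none, none) q

/-- Paths labelled `ε`, or transitions with label `l` preceded by a path labelled `ε`, where in the
first case `l` is the pair of empty words. -/
def PadStep (p : T.State) (l : Option Γ × Option Γ) (q : T.State) : Prop :=
  (l = (none, none) ∧ T.Eps p q) ∨ ∃ p', T.Eps p p' ∧ T.trans p' l q

variable {T}

theorem Eps.exists_run {p q : T.State} (h : T.Eps p q) :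
    ∃ ls, T.Run p ls q ∧ ls.filterMap Prod.fst = [] ∧ ls.filterMap Prod.snd = [] := by
  induction h using Relation.ReflTransGen.head_induction_on with
  | refl => exact ⟨[], .nil _, rfl, rfl⟩
  | head h _ ih =>
    obtain ⟨ls, h1, h2, h3⟩ := ih
    exact ⟨_ :: ls, .cons h h1, by simpa using h2, by simpa using h3⟩

theorem PadStep.exists_run {p q : T.State} {l} (h : T.PadStep p l q) :
    ∃ ls, T.Run p ls q ∧ ls.filterMap Prod.fst = l.1.toList ∧
      ls.filterMap Prod.snd = l.2.toList := by
  obtain ⟨rfl, h⟩ | ⟨p', h, h'⟩ := h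
  · exact h.exists_run
  · obtain ⟨ls, h1, h2, h3⟩ := h.exists_run
    refine ⟨ls ++ [l], T.run_append_iff.2 ⟨p', h1, .cons h' (.nil _)⟩, ?_, ?_⟩
    · rw [List.filterMap_append, h2]; rcases l with ⟨_ | _, _⟩ <;> rfl
    · rw [List.filterMap_append, h3]; rcases l with ⟨_, _ | _⟩ <;> rfl

theorem PadStep.head {p p' q : T.State} {l} (h : T.trans p (none, none) p')
    (h' : T.PadStep p' l q) : T.PadStep p l q := by
  obtain ⟨rfl, h'⟩ | ⟨p'', h', h''⟩ := h'
  · exact .inl ⟨rfl, h'.head h⟩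
  · exact .inr ⟨p'', h'.head h, h''⟩

theorem filterMap_range_succ {α : Type*} (x : ℕ → Option α) (N : ℕ) :
    (List.range (N + 1)).filterMap x = (List.range N).filterMap x ++ (x N).toList := by
  rw [List.range_succ, List.filterMap_append]
  cases h : x N <;> simp [h]

/-- `filterMap` discards the padding wherever it occurs, so no alignment of the letters is needed in
this direction. -/
theorem exists_run_of_padStep {s : ℕ → T.State} {x y : ℕ → Option Γ} {N : ℕ}
    (h : ∀ r < N, T.PadStep (s r) (x r, y r) (s (r + 1))) :
    ∃ ls, T.Run (s 0) ls (s N) ∧ ls.filterMap Prod.fst = (List.range N).filterMap x ∧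
      ls.filterMap Prod.snd = (List.range N).filterMap y := by
  induction N with
  | zero => exact ⟨[], .nil _, rfl, rfl⟩
  | succ N ih =>
    obtain ⟨ls, h1, h2, h3⟩ := ih fun r hr => h r (by omega)
    obtain ⟨ls', h1', h2', h3'⟩ := (h N (by omega)).exists_run
    exact ⟨ls ++ ls', T.run_append_iff.2 ⟨_, h1, h1'⟩,
      by rw [List.filterMap_append, h2, h2', filterMap_range_succ],
      by rw [List.filterMap_append, h3, h3', filterMap_range_succ]⟩

/-- Sequences of labels that consist of a block of labels in `Γ × Γ` followed by a block of labels
all of whose inputs, or all of whose outputs, are `ε`. -/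
def SyncLabels (ls : List (Option Γ × Option Γ)) : Prop :=
  ∃ ls₁ ls₂, ls = ls₁ ++ ls₂ ∧ (∀ l ∈ ls₁, l.1 ≠ none ∧ l.2 ≠ none) ∧
    ((∀ l ∈ ls₂, l.1 = none) ∨ (∀ l ∈ ls₂, l.2 = none))

/-- Once a label lacks an input or an output, one of the two sides has ended for good. -/
theorem SyncLabels.cons {l : Option Γ × Option Γ} {ls} (h : SyncLabels (l :: ls)) :
    SyncLabels ls ∧ ((l.1 ≠ none ∧ l.2 ≠ none) ∨ (∀ l' ∈ l :: ls, l'.1 = none) ∨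
      (∀ l' ∈ l :: ls, l'.2 = none)) := by
  obtain ⟨ls₁, ls₂, h, h1, h2⟩ := h
  rcases ls₁ with _ | ⟨l', ls₁⟩
  · obtain rfl : l :: ls = ls₂ := h
    refine ⟨⟨[], ls, rfl, by simp, h2.imp ?_ ?_⟩, .inr h2⟩ <;>
    exact fun h l hl => h l (List.mem_cons_of_mem _ hl)
  · rw [List.cons_append, List.cons.injEq] at h
    obtain ⟨rfl, rfl⟩ := h
    exact ⟨⟨ls₁, ls₂, rfl, fun l hl => h1 l (List.mem_cons_of_mem _ hl), h2⟩,
      .inl (h1 _ (List.mem_cons_self ..))⟩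

/-- Synchronization lets step `r` treat the letters number `r` of both words, `none` marking the end
of a word. Transitions labelled `ε` are merged into the step that follows them; the strict bounds on
the lengths leave a step to absorb those at the end. -/
theorem exists_padStep_of_run {ls} (hs : SyncLabels ls) {p q : T.State} (h : T.Run p ls q) {N : ℕ}
    (h1 : (ls.filterMap Prod.fst).length < N) (h2 : (ls.filterMap Prod.snd).length < N) :
    ∃ s : ℕ → T.State, s 0 = p ∧ s N = q ∧ ∀ r < N,
      T.PadStep (s r) ((ls.filterMap Prod.fst)[r]?, (ls.filterMap Prod.snd)[r]?) (s (r + 1)) := by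
  induction ls generalizing p N with
  | nil =>
    obtain rfl := T.run_nil_iff.1 h
    exact ⟨fun _ => p, rfl, rfl, fun r _ => .inl ⟨by simp, .refl⟩⟩
  | cons l ls ih =>
    obtain ⟨p', ht, hr⟩ := T.run_cons_iff.1 h
    obtain ⟨hc, hl⟩ := hs.cons
    obtain ⟨N, rfl⟩ : ∃ M, N = M + 1 := ⟨N - 1, by omega⟩
    obtain ⟨_ | x, _ | y⟩ := l
    · obtain ⟨s, rfl, rfl, hs⟩ := ih hc hr (N := N + 1) (by simpa using h1) (by simpa using h2)
      refine ⟨fun r => Nat.casesOn r p fun r => s (r + 1), rfl, rfl, fun r hr => ?_⟩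
      rcases r with _ | r
      · exact (hs 0 hr).head ht
      · exact hs (r + 1) hr
    -- A missing input means that no input remains, so shifting the indices by one changes only the
    -- output.
    · replace hl : ∀ l ∈ ls, l.1 = none := by simpa using hl
      have hu : ls.filterMap Prod.fst = [] := List.filterMap_eq_nil_iff.2 hl
      have h2' : (ls.filterMap Prod.snd).length < N := by simpa using h2
      obtain ⟨s, rfl, rfl, hs⟩ := ih hc hr (by rw [hu]; exact Nat.zero_lt_of_lt h2') h2'
      refine ⟨fun r => Nat.casesOn r p s, rfl, rfl, fun r hr => ?_⟩
      rcases r with _ | r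
      · exact .inr ⟨p, .refl, by simpa [hu] using ht⟩
      · simpa [hu] using hs r (by omega)
    · replace hl : ∀ l ∈ ls, l.2 = none := by simpa using hl
      have hu : ls.filterMap Prod.snd = [] := List.filterMap_eq_nil_iff.2 hl
      have h1' : (ls.filterMap Prod.fst).length < N := by simpa using h1
      obtain ⟨s, rfl, rfl, hs⟩ := ih hc hr h1' (by rw [hu]; exact Nat.zero_lt_of_lt h1')
      refine ⟨fun r => Nat.casesOn r p s, rfl, rfl, fun r hr => ?_⟩
      rcases r with _ | r
      · exact .inr ⟨p, .refl, by simpa [hu] using ht⟩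
      · simpa [hu] using hs r (by omega)
    · obtain ⟨s, rfl, rfl, hs⟩ := ih hc hr (by simpa using h1) (by simpa using h2)
      refine ⟨fun r => Nat.casesOn r p s, rfl, rfl, fun r hr => ?_⟩
      rcases r with _ | r
      · exact .inr ⟨p, .refl, by simpa using ht⟩
      · simpa using hs r (by omega)

end Transducer

namespace RationalGraph

variable {A : Type*} {Γ : Type}

/-- In a synchronized graph of finite out-degree, the length grows by at most a constant along an
edge. -/
theorem exists_length_le [Finite A] {G : RationalGraph A Γ} (hs : G.IsSynchronized)
    (hf : G.FiniteOutDegree) : ∃ K, ∀ u a v, G.Edge u a v → v.length ≤ u.length + K := by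
  -- The output of an input-free end of an accepting run from a state `p` is bounded: appended to
  -- one fixed run `ls₀` that reaches `p`, all these ends yield edges from a single source, of which
  -- there are finitely many.
  have key : ∀ s : Σ a, (G.transducer a).State, ∃ K, ∀ ls₁ ls₂, ∀ q ∈ (G.transducer s.1).final,
      (G.transducer s.1).Run (G.transducer s.1).start ls₁ s.2 →
      (G.transducer s.1).Run s.2 ls₂ q → (∀ l ∈ ls₂, l.1 = none) →
      (ls₂.filterMap Prod.snd).length ≤ K := by
    rintro ⟨a, p⟩
    by_cases hp : ∃ ls₁, (G.transducer a).Run (G.transducer a).start ls₁ p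
    · obtain ⟨ls₀, h₀⟩ := hp
      obtain ⟨K, hK⟩ := ((hf (ls₀.filterMap Prod.fst)).image fun e => e.2.length).bddAbove
      refine ⟨K, fun ls₁ ls₂ q hq _ h₂ hl => ?_⟩
      have := hK ⟨(a, (ls₀ ++ ls₂).filterMap Prod.snd), ⟨ls₀ ++ ls₂, q, hq,
        (G.transducer a).run_append_iff.2 ⟨p, h₀, h₂⟩, ?_, rfl⟩, rfl⟩
      · simp only [List.filterMap_append, List.length_append] at this
        omega
      · rw [List.filterMap_append, List.filterMap_eq_nil_iff.2 hl, List.append_nil]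
    · exact ⟨0, fun ls₁ _ _ _ h => absurd ⟨ls₁, h⟩ hp⟩
  choose K hK using key
  have : ∀ a, Finite (G.transducer a).State := fun a => (G.transducer a).finite_state
  obtain ⟨B, hB⟩ := (Set.finite_range K).bddAbove
  refine ⟨B, ?_⟩
  rintro _ a _ ⟨ls, q, hq, h, rfl, rfl⟩
  obtain ⟨ls₁, ls₂, rfl, h1, h2⟩ := hs a ls q h
  obtain ⟨p, hp, hp'⟩ := (G.transducer a).run_append_iff.1 h
  have e1 : (ls₁.filterMap Prod.fst).length = ls₁.length :=
    List.filterMap_length_eq_length.2 fun l hl => Option.isSome_iff_ne_none.2 (h1 l hl).1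
  have e2 : (ls₁.filterMap Prod.snd).length = ls₁.length :=
    List.filterMap_length_eq_length.2 fun l hl => Option.isSome_iff_ne_none.2 (h1 l hl).2
  simp only [List.filterMap_append, List.length_append, e1, e2]
  -- The synchronous block contributes equally to both lengths, so only an input-free end makes the
  -- target longer.
  rcases h2 with h2 | h2
  · have := hK ⟨a, p⟩ ls₁ ls₂ q hq hp hp' h2
    have := hB ⟨⟨a, p⟩, rfl⟩
    omega
  · rw [List.filterMap_eq_nil_iff.2 h2, List.length_nil]
    omega

end RationalGraph

/-- The step of an automaton reading a letter or the empty word. -/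
def optionStep {Γ σ : Type} (M : DFA Γ σ) (s : σ) (x : Option Γ) : σ :=
  x.elim s (M.step s)

theorem evalFrom_filterMap_range {Γ σ : Type} (M : DFA Γ σ) {z : ℕ → σ} {x : ℕ → Option Γ} {N : ℕ}
    (h : ∀ r < N, z (r + 1) = optionStep M (z r) (x r)) :
    M.evalFrom (z 0) ((List.range N).filterMap x) = z N := by
  induction N with
  | zero => rfl
  | succ N ih =>
    rw [Transducer.filterMap_range_succ, DFA.evalFrom_of_append, ih fun r hr => h r (by omega),
      h N (by omega)]
    cases x N <;> rfl

/-- The left quotients of `{i}` are the singletons of suffixes of `i` and the empty language. -/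
theorem isRegular_singleton {Γ : Type} (i : List Γ) : Language.IsRegular ({i} : Language Γ) := by
  apply Language.IsRegular.of_finite_range_leftQuotient
  refine ((Set.finite_range fun k : Fin (i.length + 1) => ({i.drop k} : Language Γ)).union
    (Set.finite_singleton (∅ : Set (List Γ)))).subset ?_
  rintro _ ⟨x, rfl⟩
  by_cases hx : x <+: i
  · obtain ⟨y, rfl⟩ := hx
    refine .inl ⟨⟨x.length, by simp⟩, ?_⟩
    ext z
    show z ∈ ({_} : Set _) ↔ x ++ z ∈ ({_} : Set _)
    simp
  · refine .inr ?_
    ext z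
    show x ++ z ∈ ({_} : Set _) ↔ z ∈ (∅ : Set _)
    simp only [Set.mem_singleton_iff, Set.mem_empty_iff_false, iff_false]
    rintro rfl
    exact hx ⟨z, rfl⟩

namespace RationalGraph

variable {A : Type*} {Γ : Type}

/-- A cell of the array whose columns are runs of the transducers along the edges of a path: a step
of a transducer, with its label, a step of an automaton on the source of the path, and a step of an
automaton on its target. -/
structure RunCell {N : ℕ} (G : RationalGraph (Fin N) Γ) (σ τ : Type) where
  pre : Σ a, (G.transducer a).State
  post : Σ a, (G.transducer a).State
  input : Option Γ
  output : Option Γ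
  srcPre : σ
  srcPost : σ
  tgtPre : τ
  tgtPost : τ

theorem RunCell.finite {N : ℕ} [Finite Γ] (G : RationalGraph (Fin N) Γ) (σ τ : Type) [Finite σ]
    [Finite τ] : Finite (RunCell G σ τ) := by
  have : ∀ a, Finite (G.transducer a).State := fun a => (G.transducer a).finite_state
  refine Finite.of_injective
    (fun s => (s.pre, s.post, s.input, s.output, s.srcPre, s.srcPost, s.tgtPre, s.tgtPost)) ?_
  rintro ⟨⟩ ⟨⟩ h
  simp only [Prod.mk.injEq] at h
  simpa using h

/-- The cell contains a step of a transducer. -/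
def RunCell.Valid {N : ℕ} {G : RationalGraph (Fin N) Γ} {σ τ : Type} (s : RunCell G σ τ) : Prop :=
  ∃ a p q, s.pre = ⟨a, p⟩ ∧ s.post = ⟨a, q⟩ ∧
    (G.transducer a).PadStep p (s.input, s.output) q

/-- The domino system of the paths of a synchronized graph between two regular sets. -/
def toDomino {N : ℕ} [Finite Γ] (G : RationalGraph (Fin N) Γ) (e : A → Fin N) {σ τ : Type}
    [Finite σ] [Finite τ] (M : DFA Γ σ) (M' : DFA Γ τ) : DominoSystem A where
  Symbol := {s : RunCell G σ τ // s.Valid}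
  finite_symbol := by
    have := RunCell.finite G σ τ
    infer_instance
  top a s := s.1.pre = ⟨e a, (G.transducer (e a)).start⟩ ∧ s.1.srcPre = M.start ∧
    s.1.tgtPre = M'.start
  left s := s.1.srcPost = optionStep M s.1.srcPre s.1.input
  right s := s.1.tgtPost = optionStep M' s.1.tgtPre s.1.output
  bot s := (s.1.post.2 ∈ (G.transducer s.1.post.1).final) ∧ s.1.srcPost ∈ M.accept ∧
    s.1.tgtPost ∈ M'.accept
  hor s t := s.1.output = t.1.input
  ver s t := s.1.post = t.1.pre ∧ s.1.srcPost = t.1.srcPre ∧ s.1.tgtPost = t.1.tgtPre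

section

variable {N : ℕ} [Finite Γ] (G : RationalGraph (Fin N) Γ) (e : A → Fin N) {σ τ : Type}
  [Finite σ] [Finite τ] (M : DFA Γ σ) (M' : DFA Γ τ)

/-- The words read down the boundaries between columns are the vertices of a path, as `hor`
identifies the outputs of a column with the inputs of the next. The steps of `M` are enforced only
in the first column and those of `M'` only in the last, which is enough for the source and the
target. -/
theorem mem_pathLanguage_of_toDomino {w : List A} {n : ℕ} (h : (G.toDomino e M M').Accepts w n) :
    w.map e ∈ G.pathLanguage M.accepts M'.accepts := by
  obtain ⟨hw, f, hf⟩ := h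
  have hm : 0 < w.length := List.length_pos_iff.2 hw
  obtain ⟨col, hcol0, hcol1⟩ : ∃ col : ℕ → ℕ → Option Γ, (∀ r, col 0 r = (f r 0).1.input) ∧
    ∀ k r, col (k + 1) r = (f r k).1.output :=
    ⟨fun k r => Nat.casesOn k (f r 0).1.input fun k => (f r k).1.output, fun _ => rfl, fun _ _ => rfl⟩
  have hin : ∀ r ≤ n, ∀ k < w.length, (f r k).1.input = col k r := by
    rintro r hr (_ | k) hk
    · rw [hcol0]
    · rw [hcol1]; exact (hf.hor r hr k hk).symm
  have hsrc : (List.range (n + 1)).filterMap (col 0) ∈ M.accepts := by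
    obtain ⟨z, hz0, hz1⟩ : ∃ z : ℕ → σ, z 0 = (f 0 0).1.srcPre ∧
        ∀ r, z (r + 1) = (f r 0).1.srcPost :=
      ⟨fun k => Nat.casesOn k (f 0 0).1.srcPre fun k => (f k 0).1.srcPost, rfl, fun _ => rfl⟩
    have hz : ∀ r ≤ n, z r = (f r 0).1.srcPre := by
      rintro (_ | r) hr
      · exact hz0
      · rw [hz1]; exact (hf.ver r hr 0 hm).2.1
    have := evalFrom_filterMap_range M (z := z) (x := col 0) (N := n + 1) fun r hr => by
      rw [hz1, hz r (by omega), hcol0]; exact hf.left r (by omega)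
    rw [DFA.mem_accepts, DFA.eval, ← (hf.top 0 hm).2.1, ← hz0, this, hz1]
    exact (hf.bot 0 hm).2.1
  have htgt : (List.range (n + 1)).filterMap (col w.length) ∈ M'.accepts := by
    obtain ⟨m, hm'⟩ : ∃ m, w.length = m + 1 := ⟨w.length - 1, by omega⟩
    have hr := hf.right
    rw [hm', Nat.add_sub_cancel] at hr
    obtain ⟨z, hz0, hz1⟩ : ∃ z : ℕ → τ, z 0 = (f 0 m).1.tgtPre ∧
        ∀ r, z (r + 1) = (f r m).1.tgtPost :=
      ⟨fun k => Nat.casesOn k (f 0 m).1.tgtPre fun k => (f k m).1.tgtPost, rfl, fun _ => rfl⟩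
    have hz : ∀ r ≤ n, z r = (f r m).1.tgtPre := by
      rintro (_ | r) hr
      · exact hz0
      · rw [hz1]; exact (hf.ver r hr m (by omega)).2.2
    have := evalFrom_filterMap_range M' (z := z) (x := col w.length) (N := n + 1) fun r hr' => by
      rw [hz1, hz r (by omega), hm', hcol1]; exact hr r (by omega)
    rw [DFA.mem_accepts, DFA.eval, ← (hf.top m (by omega)).2.2, ← hz0, this, hz1]
    exact (hf.bot m (by omega)).2.2
  refine ⟨_, hsrc, _, htgt, G.path_iff_exists_vertices.2
    ⟨fun k => (List.range (n + 1)).filterMap (col k), rfl, by simp, fun k hk => ?_⟩⟩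
  have hk : k < w.length := by simpa using hk
  rw [List.getElem_map]
  -- The label of the transducer is preserved within a cell by `Valid` and between cells by `ver`,
  -- so each column is a run of the one transducer fixed by its top entry.
  have hst : ∀ r, ∃ s : (G.transducer (e w[k])).State, r ≤ n + 1 →
      (r ≤ n → (f r k).1.pre = ⟨_, s⟩) ∧ (∀ r', r = r' + 1 → (f r' k).1.post = ⟨_, s⟩) := by
    intro r
    induction r with
    | zero => exact ⟨_, fun _ => ⟨fun _ => (hf.top k hk).1, fun r' h => by omega⟩⟩
    | succ r ih =>
      by_cases hr : r + 1 ≤ n + 1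
      · obtain ⟨s, hs⟩ := ih
        obtain ⟨a, p, q, h1, h2, -⟩ := (f r k).2
        rw [(hs (by omega)).1 (by omega)] at h1
        cases h1
        refine ⟨q, fun _ => ⟨fun hr' => ?_, fun r' h => ?_⟩⟩
        · rw [← (hf.ver r hr' k hk).1]; exact h2
        · obtain rfl : r = r' := by omega
          exact h2
      · exact ⟨(G.transducer (e w[k])).start, fun h => absurd h hr⟩
  choose s hs using hst
  have hstep : ∀ r < n + 1, (G.transducer (e w[k])).PadStep (s r) (col k r, col (k + 1) r)
      (s (r + 1)) := by
    intro r hr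
    obtain ⟨a, p, q, h1, h2, h⟩ := (f r k).2
    rw [(hs r (by omega)).1 (by omega)] at h1
    rw [(hs (r + 1) (by omega)).2 r rfl] at h2
    cases h1
    cases h2
    rwa [hin r (by omega) k hk, ← hcol1] at h
  obtain ⟨ls, h1, h2, h3⟩ := Transducer.exists_run_of_padStep hstep
  refine ⟨ls, s (n + 1), ?_, ?_, h2, h3⟩
  · have := (hf.bot k hk).1
    rwa [(hs (n + 1) le_rfl).2 n rfl] at this
  · have h0 := (hf.top k hk).1
    rw [(hs 0 (by omega)).1 (by omega)] at h0
    have h0 : s 0 = (G.transducer (e w[k])).start := by simpa using h0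
    rwa [h0] at h1

theorem filterMap_range_getElem? {α : Type*} (u : List α) {N : ℕ} (hN : u.length ≤ N) :
    (List.range N).filterMap (fun r => u[r]?) = u := by
  induction u generalizing N with
  | nil => simp
  | cons x u ih =>
    obtain ⟨N, rfl⟩ : ∃ M, N = M + 1 := ⟨N - 1, by simp at hN; omega⟩
    rw [List.range_succ_eq_map, List.filterMap_cons_some (b := x) (by simp), List.filterMap_map]
    simpa [Function.comp_def] using ih (by simpa using hN)

/-- The vertex after `k` letters has length at most `l + K * k`, so `(l + K) * w.length` bounds all
lengths; one more row leaves room for trailing `ε`-transitions. -/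
theorem toDomino_accepts (hs : G.IsSynchronized) {K : ℕ}
    (hK : ∀ u a v, G.Edge u a v → v.length ≤ u.length + K) {l : ℕ}
    (hl : ∀ u ∈ M.accepts, u.length ≤ l) {w : List A} (hw : w ≠ [])
    (h : w.map e ∈ G.pathLanguage M.accepts M'.accepts) :
    (G.toDomino e M M').Accepts w ((l + K) * w.length) := by
  obtain ⟨u, hu, v, hv, h⟩ := h
  obtain ⟨g, rfl, rfl, hg⟩ := G.path_iff_exists_vertices.1 h
  rw [List.length_map] at hv
  have hm : 0 < w.length := List.length_pos_iff.2 hw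
  have hg' : ∀ k (hk : k < w.length), G.Edge (g k) (e w[k]) (g (k + 1)) := by
    intro k hk
    have := hg k (by simpa using hk)
    rwa [List.getElem_map] at this
  have hlen : ∀ k ≤ w.length, (g k).length ≤ l + K * k := by
    intro k
    induction k with
    | zero => exact fun _ => hl _ hu
    | succ k ih =>
      intro hk
      have := hK _ _ _ (hg' k hk)
      have := ih (by omega)
      rw [mul_add]
      omega
  generalize hn : (l + K) * w.length = n
  have hlen : ∀ k ≤ w.length, (g k).length ≤ n := fun k hk => (hlen k hk).trans (by
    rw [← hn]
    nlinarith [Nat.mul_le_mul_left K hk, Nat.mul_le_mul_left l hm])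
  have hruns : ∀ k, ∃ s : ℕ → Σ a, (G.transducer a).State, ∀ hk : k < w.length,
      s 0 = ⟨e w[k], (G.transducer _).start⟩ ∧
      ((s (n + 1)).2 ∈ (G.transducer (s (n + 1)).1).final) ∧
      ∀ r ≤ n, ∃ a p q, s r = ⟨a, p⟩ ∧ s (r + 1) = ⟨a, q⟩ ∧
        (G.transducer a).PadStep p ((g k)[r]?, (g (k + 1))[r]?) q := by
    intro k
    by_cases hk : k < w.length
    · obtain ⟨ls, q, hq, h, h1, h2⟩ := hg' k hk
      obtain ⟨s, h3, h4, h5⟩ := Transducer.exists_padStep_of_run (hs _ ls q h) h (N := n + 1)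
        (by rw [h1]; exact Nat.lt_succ_of_le (hlen k hk.le))
        (by rw [h2]; exact Nat.lt_succ_of_le (hlen (k + 1) hk))
      rw [h1, h2] at h5
      refine ⟨fun r => ⟨_, s r⟩, fun _ => ⟨congrArg (Sigma.mk _) h3, ?_, fun r hr => ?_⟩⟩
      · show s (n + 1) ∈ _
        rwa [h4]
      · exact ⟨_, _, _, rfl, rfl, h5 r (by omega)⟩
    · exact ⟨fun _ => ⟨e (w.head hw), (G.transducer _).start⟩, fun h => absurd h hk⟩
  choose s hs0 hs1 hs2 using hruns
  obtain ⟨z, hz0, hz1⟩ : ∃ z : ℕ → σ, z 0 = M.start ∧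
      ∀ r, z (r + 1) = optionStep M (z r) (g 0)[r]? :=
    ⟨fun r => Nat.rec M.start (fun r z => optionStep M z (g 0)[r]?) r, rfl, fun _ => rfl⟩
  obtain ⟨t, ht0, ht1⟩ : ∃ t : ℕ → τ, t 0 = M'.start ∧
      ∀ r, t (r + 1) = optionStep M' (t r) (g w.length)[r]? :=
    ⟨fun r => Nat.rec M'.start (fun r t => optionStep M' t (g w.length)[r]?) r, rfl, fun _ => rfl⟩
  have hz2 : z (n + 1) ∈ M.accept := by
    have := evalFrom_filterMap_range M (N := n + 1) fun r _ => hz1 r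
    rw [filterMap_range_getElem? _ ((hlen 0 (by omega)).trans (by omega)), hz0] at this
    rw [← this]
    exact hu
  have ht2 : t (n + 1) ∈ M'.accept := by
    have := evalFrom_filterMap_range M' (N := n + 1) fun r _ => ht1 r
    rw [filterMap_range_getElem? _ ((hlen _ le_rfl).trans (by omega)), ht0] at this
    rw [← this]
    exact hv
  obtain ⟨f, hf⟩ := exists_subtype_array (P := RunCell.Valid) (n := n) hm
    (fun r k => (⟨s k r, s k (r + 1), (g k)[r]?, (g (k + 1))[r]?, z r, z (r + 1), t r, t (r + 1)⟩ :
      RunCell G σ τ)) fun r hr k hk => hs2 k hk r hr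
  refine ⟨hw, f, ?_, ?_, ?_, ?_, ?_, ?_⟩
  · intro k hk
    simp only [toDomino, hf 0 (Nat.zero_le _) k hk]
    exact ⟨hs0 k hk, hz0, ht0⟩
  · intro r hr
    simp only [toDomino, hf r hr 0 hm]
    exact hz1 r
  · intro r hr
    simp only [toDomino, hf r hr (w.length - 1) (by omega)]
    rw [Nat.sub_add_cancel hm]
    exact ht1 r
  · intro k hk
    have hc := hf n le_rfl k hk
    refine ⟨?_, by rw [hc]; exact hz2, by rw [hc]; exact ht2⟩
    rw [show (f n k).1.post = s k (n + 1) by rw [hc]]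
    exact hs1 k hk
  · intro r hr k hk
    simp only [toDomino, hf r hr k (by omega), hf r hr _ hk]
  · intro r hr k hk
    simp only [toDomino, hf r hr.le k hk, hf _ hr k hk, and_self]

end

/-- Renaming of the labels of a graph. -/
def relabel {B : Type*} (G : RationalGraph A Γ) (e : B → A) : RationalGraph B Γ where
  transducer b := G.transducer (e b)

theorem relabel_path {B : Type*} (G : RationalGraph A Γ) (e : B → A) {u w v} :
    (G.relabel e).Path u w v ↔ G.Path u (w.map e) v := by
  rw [path_iff_exists_vertices, path_iff_exists_vertices]
  simp [relabel, Edge]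

end RationalGraph

theorem AcceptedBySynchronizedGraph.acceptedByDominoes {A : Type*} [Finite A] {L : Language A}
    (hL : [] ∉ L) (h : AcceptedBySynchronizedGraph L) : AcceptedByDominoes L := by
  obtain ⟨Γ, _, G, i, F, hs, hf, ⟨τ, _, M', rfl⟩, rfl⟩ := h
  obtain ⟨σ, _, M, hM⟩ := isRegular_singleton i
  obtain ⟨K, hK⟩ := G.exists_length_le hs hf
  -- The symbols of a domino system lie in `Type` and mention labels of the graph; labels from an
  -- arbitrary universe are first replaced by numbers.
  have e := Finite.equivFin A
  have key : ∀ w, w ∈ G.pathLanguage {i} M'.accepts ↔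
      w.map e ∈ (G.relabel e.symm).pathLanguage M.accepts M'.accepts := by
    intro w
    rw [hM]
    refine exists_congr fun u => and_congr_right fun _ => exists_congr fun v =>
      and_congr_right fun _ => ?_
    rw [RationalGraph.relabel_path]
    simp
  refine ⟨(G.relabel e.symm).toDomino e M M', i.length + K, fun w n h => ?_, fun w hw => ?_⟩
  · exact (key w).2 ((G.relabel e.symm).mem_pathLanguage_of_toDomino e M M' h)
  · refine ⟨_, le_rfl, (G.relabel e.symm).toDomino_accepts e M M' (fun a => hs _)
      (fun u a v h => hK u _ v h) (fun u hu => ?_) ?_ ((key w).1 hw)⟩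
    · rw [hM] at hu
      exact (congrArg List.length (Set.mem_singleton_iff.1 hu)).le
    · rintro rfl
      exact hL hw

/-! ### Computations of linearly bounded machines -/

namespace LBM

variable {A : Type*} (M : LBM A)

theorem Run.append {M : LBM A} {c c' c'' : M.Config} {ds ds' : List Move} (h : M.Run c ds c')
    (h' : M.Run c' ds' c'') : M.Run c (ds ++ ds') c'' := by
  induction h with
  | nil => exact h'
  | cons h _ ih => exact .cons h (ih h')

theorem changes_append_le (ds ds' : List Move) :
    changes (ds ++ ds') ≤ changes ds + changes ds' + 1 := by
  induction ds with
  | nil => simp [changes]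
  | cons a ds ih =>
    rcases ds with _ | ⟨b, ds⟩
    · rcases ds' with _ | ⟨b, ds'⟩
      · simp [changes]
      · simp only [List.cons_append, List.nil_append, changes]
        split_ifs <;> omega
    · simp only [List.cons_append, changes] at ih ⊢
      omega

theorem changes_replicate (n : ℕ) (d : Move) : changes (List.replicate n d) = 0 := by
  induction n with
  | zero => rfl
  | succ n ih =>
    rcases n with _ | n
    · rfl
    · simpa [List.replicate_succ, changes] using ih

theorem reversals_append_le (ds ds' : List Move) :
    reversals (ds ++ ds') ≤ reversals ds + reversals ds' + 1 := by
  rw [reversals, List.filter_append]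
  exact changes_append_le _ _

theorem reversals_replicate (n : ℕ) (d : Move) : reversals (List.replicate n d) = 0 := by
  rw [reversals, List.filter_replicate]
  split_ifs
  · exact changes_replicate _ _
  · rfl

end LBM

/-! ### From domino systems to linearly bounded machines -/

namespace DominoSystem

variable {A : Type*}

/-- States of the machine that writes the rows of a picture one after the other: `write o` if the
row is being written and `o` is the last symbol written in it, `back` and `check` on the way back to
the left end. -/
inductive WriterState (S : Type) where
  | write (o : Option S) : WriterState S
  | back : WriterState S
  | check : WriterState S
  | done : WriterState S

theorem WriterState.finite (S : Type) [Finite S] : Finite (WriterState S) := by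
  refine Finite.of_injective (β := Option S ⊕ Fin 3)
    (fun s => match s with
      | .write o => .inl o
      | .back => .inr 0
      | .check => .inr 1
      | .done => .inr 2) ?_
  rintro (_ | _ | _ | _) (_ | _ | _ | _) <;> simp

variable (D : DominoSystem A) {B : Type} (e : A ≃ B)

/-- The symbol `t` may be written below `z`. -/
def Below : B ⊕ D.Symbol → D.Symbol → Prop
  | .inl b, t => D.top (e.symm b) t
  | .inr s, t => D.ver s t

/-- The symbol `t` may be written after `o`. -/
def After : Option D.Symbol → D.Symbol → Prop
  | none, t => D.left t
  | some s, t => D.hor s t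

/-- The transitions of the machine that writes the rows of a picture. -/
inductive WriterTrans : WriterState D.Symbol → Cell (Option (B ⊕ D.Symbol)) →
    WriterState D.Symbol → Cell (Option (B ⊕ D.Symbol)) → Move → Prop
  | write {z o t} : D.Below e z t → D.After o t → WriterTrans (.write o) (.letter (some z))
      (.write (some t)) (.letter (some (.inr t))) .right
  | turn {s} : D.right s → WriterTrans (.write (some s)) .rightEnd .back .rightEnd .left
  | turnCheck {s} : D.right s → WriterTrans (.write (some s)) .rightEnd .check .rightEnd .left
  | back {x} : WriterTrans .back (.letter x) .back (.letter x) .left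
  | restart : WriterTrans .back .leftEnd (.write none) .leftEnd .right
  | check {s} : D.bot s → WriterTrans .check (.letter (some (.inr s))) .check
      (.letter (some (.inr s))) .left
  | accept : WriterTrans .check .leftEnd .done .leftEnd .stay

/-- The machine that writes the rows of a picture one after the other. -/
def writer [Finite B] : LBM A where
  State := WriterState D.Symbol
  finite_state := by
    have := D.finite_symbol
    exact WriterState.finite _
  Symbol := Option (B ⊕ D.Symbol)
  finite_symbol := by
    have := D.finite_symbol
    infer_instance
  input := ⟨fun a => some (.inl (e a)), fun a b h => by simpa using h⟩
  blank := none
  blank_not_input := by simp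
  extra := 0
  start := .write none
  accept := {.done}
  trans := D.WriterTrans e
  trans_leftEnd := by rintro p q y d ⟨⟩ <;> simp
  trans_rightEnd := by rintro p q y d ⟨⟩ <;> simp
  trans_letter := by rintro p x q y d ⟨⟩ <;> simp

/-- The row `ts` may be written below `zs`, after `o`. -/
def RowRel : Option D.Symbol → List (B ⊕ D.Symbol) → List D.Symbol → Prop
  | some s, [], [] => D.right s
  | o, z :: zs, t :: ts => D.Below e z t ∧ D.After o t ∧ RowRel (some t) zs ts
  | _, _, _ => False

/-- `D.Rows e w n zs`: the word `zs` is the last row of an incomplete picture with `n` rows below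
the word `w`. -/
inductive Rows (w : List A) : ℕ → List (B ⊕ D.Symbol) → Prop
  | zero : Rows w 0 (w.map fun a => .inl (e a))
  | succ {n zs ts} : Rows w n zs → D.RowRel e none zs ts → Rows w (n + 1) (ts.map .inr)

/-! ### Rows written by the machine and pictures -/

variable {D e}

theorem rowRel_cons {o : Option D.Symbol} {z : B ⊕ D.Symbol} {t zs ts} :
    D.RowRel e o (z :: zs) (t :: ts) ↔
      D.Below e z t ∧ D.After o t ∧ D.RowRel e (some t) zs ts := by
  cases o <;> rfl

theorem Rows.exists_pred {w : List A} {n : ℕ} {ts : List D.Symbol}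
    (h : D.Rows e w (n + 1) (ts.map .inr)) : ∃ zs, D.Rows e w n zs ∧ D.RowRel e none zs ts := by
  generalize hz : (ts.map .inr : List (B ⊕ D.Symbol)) = z at h
  cases h with
  | succ h hr =>
    obtain rfl := List.map_injective_iff.2 Sum.inr_injective hz
    exact ⟨_, h, hr⟩

theorem rowRel_iff {o : Option D.Symbol} {zs : List (B ⊕ D.Symbol)} {ts : List D.Symbol} :
    D.RowRel e o zs ts ↔ ts.length = zs.length ∧
      (∀ (j : ℕ) z t, zs[j]? = some z → ts[j]? = some t → D.Below e z t) ∧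
      (∀ t, ts[0]? = some t → D.After o t) ∧
      (∀ (j : ℕ) s t, ts[j]? = some s → ts[j + 1]? = some t → D.hor s t) ∧
      ∃ s, ts.getLast?.or o = some s ∧ D.right s := by
  induction zs generalizing o ts with
  | nil =>
    rcases ts with _ | ⟨t, ts⟩
    · rcases o with _ | s <;> simp [RowRel]
    · simp [RowRel]
  | cons z zs ih =>
    rcases ts with _ | ⟨t, ts⟩
    · simp [RowRel]
    · have hl : ((t :: ts).getLast?).or o = ts.getLast?.or (some t) := by
        rw [List.getLast?_cons]
        cases ts.getLast? <;> rfl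
      simp only [RowRel, ih, List.length_cons, Nat.add_right_cancel_iff, List.getElem?_cons_zero,
        Option.some.injEq, forall_eq', List.getElem?_cons_succ, hl]
      constructor
      · rintro ⟨h1, h2, h3, h4, h5, h6, h7⟩
        refine ⟨h3, ?_, h2, ?_, h7⟩
        · rintro (_ | j) z' t' hz ht
          · cases hz; cases ht; exact h1
          · exact h4 _ _ _ hz ht
        · rintro (_ | j) s t' hs ht
          · cases hs; exact h5 _ ht
          · exact h6 _ _ _ hs ht
      · rintro ⟨h1, h2, h3, h4, h5⟩
        exact ⟨h2 0 _ _ rfl rfl, h3, h1, fun j => h2 (j + 1), fun t' ht => h4 0 _ _ rfl ht,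
          fun j => h4 (j + 1), h5⟩

theorem Rows.exists_sequence {w : List A} {n : ℕ} {ts : List D.Symbol}
    (h : D.Rows e w (n + 1) (ts.map .inr)) : ∃ g : ℕ → List D.Symbol, g n = ts ∧
      D.RowRel e none (w.map fun a => .inl (e a)) (g 0) ∧
      ∀ i < n, D.RowRel e none ((g i).map .inr) (g (i + 1)) := by
  induction n generalizing ts with
  | zero =>
    obtain ⟨zs, h, hr⟩ := h.exists_pred
    cases h
    exact ⟨fun _ => ts, rfl, hr, by simp⟩
  | succ n ih =>
    obtain ⟨zs, h, hr⟩ := h.exists_pred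
    obtain ⟨ts', rfl⟩ : ∃ ts' : List D.Symbol, zs = ts'.map .inr := by
      cases h
      exact ⟨_, rfl⟩
    obtain ⟨g, rfl, h1, h2⟩ := ih h
    refine ⟨fun i => if i ≤ n then g i else ts, by simp, by simpa using h1, fun i hi => ?_⟩
    rcases Nat.lt_or_ge i n with hi' | hi'
    · simpa [hi'.le, Nat.succ_le_of_lt hi'] using h2 i hi'
    · obtain rfl : i = n := by omega
      simpa using hr

theorem Rows.accepts {w : List A} {n : ℕ} {ts : List D.Symbol}
    (h : D.Rows e w (n + 1) (ts.map .inr)) (hb : ∀ s ∈ ts, D.bot s) : D.Accepts w n := by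
  obtain ⟨g, rfl, h0, h1⟩ := h.exists_sequence
  rw [rowRel_iff] at h0
  simp only [rowRel_iff] at h1
  have hlen : ∀ i ≤ n, (g i).length = w.length := by
    intro i
    induction i with
    | zero => simpa using h0.1
    | succ i ih =>
      intro hi
      rw [(h1 i hi).1, List.length_map, ih (by omega)]
  have hside : ∀ i ≤ n, (∀ t, (g i)[0]? = some t → D.left t) ∧
      (∀ (j : ℕ) s t, (g i)[j]? = some s → (g i)[j + 1]? = some t → D.hor s t) ∧
      ∃ s, (g i).getLast? = some s ∧ D.right s := by
    rintro (_ | i) hi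
    · simpa [After] using h0.2.2
    · simpa [After] using (h1 i hi).2.2
  have hw : w ≠ [] := by
    rintro rfl
    obtain ⟨s, hs, -⟩ := (hside 0 (Nat.zero_le _)).2.2
    rw [List.length_eq_zero_iff.1 (hlen 0 (Nat.zero_le _))] at hs
    cases hs
  have hm : 0 < w.length := List.length_pos_iff.2 hw
  have hget : ∀ i j, ∃ s, i ≤ n → j < w.length → (g i)[j]? = some s := by
    intro i j
    by_cases h : i ≤ n ∧ j < w.length
    · exact ⟨_, fun _ _ => List.getElem?_eq_getElem (by rw [hlen i h.1]; exact h.2)⟩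
    · obtain ⟨s, -⟩ := (hside 0 (Nat.zero_le _)).2.2
      exact ⟨s, fun a b => absurd ⟨a, b⟩ h⟩
  choose f hf using hget
  refine ⟨hw, f, ?_, ?_, ?_, ?_, ?_, ?_⟩
  · intro j hj
    have := h0.2.1 j _ _ (by rw [List.getElem?_map, List.getElem?_eq_getElem hj]; rfl)
      (hf 0 j (Nat.zero_le _) hj)
    simpa [Below] using this
  · exact fun i hi => (hside i hi).1 _ (hf i 0 hi hm)
  · intro i hi
    obtain ⟨s, hs, hs'⟩ := (hside i hi).2.2
    rw [List.getLast?_eq_getElem?, hlen i hi, hf i _ hi (by omega)] at hs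
    cases hs
    exact hs'
  · exact fun j hj => hb _ (List.mem_of_getElem? (hf n j le_rfl hj))
  · exact fun i hi j hj => (hside i hi).2.1 j _ _ (hf i j hi (by omega)) (hf i _ hi hj)
  · intro i hi j hj
    exact (h1 i hi).2.1 j _ _ (by rw [List.getElem?_map, hf i j hi.le hj]; rfl) (hf _ j hi hj)

theorem IsPicture.rowRel {w : List A} {n : ℕ} {f : ℕ → ℕ → D.Symbol} (hw : w ≠ [])
    (hf : D.IsPicture w n f) {i : ℕ} (hi : i ≤ n) {zs : List (B ⊕ D.Symbol)}
    (hzs : zs.length = w.length) (hb : ∀ (j : ℕ) z, zs[j]? = some z → D.Below e z (f i j)) :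
    D.RowRel e none zs ((List.range w.length).map (f i)) := by
  have hm : 0 < w.length := List.length_pos_iff.2 hw
  have hget : ∀ {j : ℕ} {s}, ((List.range w.length).map (f i))[j]? = some s →
      j < w.length ∧ s = f i j := by
    intro j s h
    simp only [List.getElem?_map, Option.map_eq_some_iff, List.getElem?_eq_some_iff,
      List.length_range, List.getElem_range] at h
    obtain ⟨_, ⟨h1, rfl⟩, rfl⟩ := h
    exact ⟨h1, rfl⟩
  rw [rowRel_iff]
  refine ⟨by simp [hzs], ?_, ?_, ?_, f i (w.length - 1), ?_, hf.right i hi⟩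
  · intro j z t hz ht
    obtain ⟨-, rfl⟩ := hget ht
    exact hb j z hz
  · intro t ht
    obtain ⟨-, rfl⟩ := hget ht
    exact hf.left i hi
  · intro j s t hs ht
    obtain ⟨-, rfl⟩ := hget hs
    obtain ⟨hj, rfl⟩ := hget ht
    exact hf.hor i hi j hj
  · simp [List.getLast?_eq_getElem?, hm]

theorem IsPicture.rows {w : List A} {n : ℕ} {f : ℕ → ℕ → D.Symbol} (hw : w ≠ [])
    (hf : D.IsPicture w n f) {i : ℕ} (hi : i ≤ n) :
    D.Rows e w (i + 1) (((List.range w.length).map (f i)).map .inr) := by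
  induction i with
  | zero =>
    refine .succ .zero (hf.rowRel hw hi (by simp) fun j z hz => ?_)
    rw [List.getElem?_map, Option.map_eq_some_iff] at hz
    obtain ⟨a, ha, rfl⟩ := hz
    obtain ⟨h, rfl⟩ := List.getElem?_eq_some_iff.1 ha
    simpa [Below] using hf.top j h
  | succ i ih =>
    refine .succ (ih (by omega)) (hf.rowRel hw hi (by simp) fun j z hz => ?_)
    simp only [List.getElem?_map, Option.map_eq_some_iff, List.getElem?_eq_some_iff,
      List.length_range, List.getElem_range] at hz
    obtain ⟨_, ⟨_, ⟨h1, rfl⟩, rfl⟩, rfl⟩ := hz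
    exact hf.ver i hi j h1

/-- The tape of the machine with contents `zs`. -/
def writerTape (zs : List (B ⊕ D.Symbol)) : List (Cell (Option (B ⊕ D.Symbol))) :=
  .leftEnd :: (zs.map fun z => .letter (some z)) ++ [.rightEnd]

theorem writerTape_zero (zs : List (B ⊕ D.Symbol)) : (writerTape zs)[0]? = some .leftEnd := rfl

theorem writerTape_length (zs : List (B ⊕ D.Symbol)) :
    (writerTape zs)[zs.length + 1]? = some .rightEnd := by
  simp [writerTape]

theorem writerTape_succ {zs : List (B ⊕ D.Symbol)} {j : ℕ} {z} (h : zs[j]? = some z) :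
    (writerTape zs)[j + 1]? = some (.letter (some z)) := by
  obtain ⟨hj, rfl⟩ := List.getElem?_eq_some_iff.1 h
  rw [writerTape, List.cons_append, List.getElem?_cons_succ,
    List.getElem?_append_left (by simpa using hj)]
  simp

theorem writerTape_set (zs : List (B ⊕ D.Symbol)) {j : ℕ} (h : j < zs.length) (z) :
    (writerTape zs).set (j + 1) (.letter (some z)) = writerTape (zs.set j z) := by
  simp [writerTape, h]

theorem writerTape_cases {zs : List (B ⊕ D.Symbol)} {j : ℕ} {x} (h : (writerTape zs)[j]? = some x) :
    (j = 0 ∧ x = .leftEnd) ∨ (∃ i z, j = i + 1 ∧ zs[i]? = some z ∧ x = .letter (some z)) ∨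
      (j = zs.length + 1 ∧ x = .rightEnd) := by
  rcases j with _ | j
  · rw [writerTape_zero] at h; cases h; exact .inl ⟨rfl, rfl⟩
  · rcases lt_trichotomy j zs.length with hj | rfl | hj
    · rw [writerTape_succ (List.getElem?_eq_getElem hj)] at h
      cases h
      exact .inr (.inl ⟨j, _, rfl, List.getElem?_eq_getElem hj, rfl⟩)
    · rw [writerTape_length] at h; cases h; exact .inr (.inr ⟨rfl, rfl⟩)
    · rw [List.getElem?_eq_none] at h
      · cases h
      · simp [writerTape]; omega

theorem set_eq_self {α : Type*} {l : List α} {j : ℕ} {x : α} (h : l[j]? = some x) :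
    l.set j x = l := by
  obtain ⟨hj, rfl⟩ := List.getElem?_eq_some_iff.1 h
  exact List.set_getElem_self hj

/-! ### Computations of the machine that writes rows -/

section

variable [Finite B]

theorem writer_init (w : List A) : (D.writer e).init w =
    ⟨.write none, 1, writerTape (w.map fun a => .inl (e a))⟩ := by
  have : ((D.writer e).init w).tape = writerTape (w.map fun a => .inl (e a)) := by
    show [Cell.leftEnd] ++ (w.map (fun a => some (Sum.inl (e a))) ++
      List.replicate (0 * w.length) none).map Cell.letter ++ [Cell.rightEnd] = _
    simp [writerTape]
  exact congrArg (fun t => (⟨WriterState.write none, 1, t⟩ : (D.writer e).Config)) this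

/-- The configurations of the machine that are reachable from the initial one. -/
def WriterInv (w : List A) (c : (D.writer e).Config) : Prop :=
  match (c.state : WriterState D.Symbol) with
  | .write o => ∃ n zs pre rest, D.Rows e w n zs ∧ c.tape = writerTape (pre.map .inr ++ rest) ∧
      c.head = pre.length + 1 ∧ ∀ ts, D.RowRel e o rest ts → D.RowRel e none zs (pre ++ ts)
  | .back => ∃ (n : ℕ) (ts : List D.Symbol), D.Rows e w n (ts.map .inr) ∧ c.tape = writerTape (ts.map .inr)
  | .check => ∃ (n : ℕ) (ts : List D.Symbol), D.Rows e w (n + 1) (ts.map .inr) ∧ c.tape = writerTape (ts.map .inr) ∧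
      ∀ (j : ℕ) s, c.head ≤ j → ts[j]? = some s → D.bot s
  | .done => ∃ (n : ℕ) (ts : List D.Symbol), D.Rows e w (n + 1) (ts.map .inr) ∧ ∀ s ∈ ts, D.bot s

/-- While a row is written, the invariant speaks of its continuations: whatever can be written on
the remaining cells after `o` completes a row below `zs`. Hence remembering one symbol suffices.
During the check, entry `j` lies at position `j + 1` of the tape, so `c.head ≤ j` singles out the
entries to the right of the head, which have been verified. -/
theorem WriterInv.step {w : List A} {c c' : (D.writer e).Config} {d : Move}
    (h : WriterInv w c) (hs : (D.writer e).Step c d c') : WriterInv w c' := by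
  obtain ⟨q, h', t'⟩ := c'
  obtain ⟨p, hd, t⟩ := c
  obtain ⟨x, y, hx, ht, rfl, rfl⟩ := hs
  dsimp only at hx ht ⊢
  change D.WriterTrans e p x q y d at ht
  cases ht with
  | @write z o s hb ha =>
    obtain ⟨n, zs, pre, rest, h1, rfl, rfl, h4⟩ := h
    obtain ⟨h, -⟩ | ⟨i, z', h, hz, h'⟩ | ⟨-, h⟩ := writerTape_cases hx
    · omega
    · cases h'
      obtain rfl : i = pre.length := by omega
      rcases rest with _ | ⟨z', rest⟩
      · simp at hz
      · obtain rfl : z' = z := by simpa using hz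
        refine ⟨n, zs, pre ++ [s], rest, h1, ?_, by simp [LBM.moveHead], fun ts hts => ?_⟩
        · refine (writerTape_set _ (by simp) _).trans ?_
          simp
        · simpa using h4 (s :: ts) (rowRel_cons.2 ⟨hb, ha, hts⟩)
    · cases h
  | @turn s hr =>
    obtain ⟨n, zs, pre, rest, h1, rfl, rfl, h4⟩ := h
    obtain ⟨-, h⟩ | ⟨_, _, _, _, h⟩ | ⟨h, -⟩ := writerTape_cases hx
    · cases h
    · cases h
    · obtain rfl : rest = [] := by simpa using h
      have := h4 [] hr
      rw [List.append_nil] at this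
      refine ⟨n + 1, pre, h1.succ this, ?_⟩
      rw [List.append_nil] at hx ⊢
      exact set_eq_self hx
  | @turnCheck s hr =>
    obtain ⟨n, zs, pre, rest, h1, rfl, rfl, h4⟩ := h
    obtain ⟨-, h⟩ | ⟨_, _, _, _, h⟩ | ⟨h, -⟩ := writerTape_cases hx
    · cases h
    · cases h
    · obtain rfl : rest = [] := by simpa using h
      have := h4 [] hr
      rw [List.append_nil] at this
      refine ⟨n, pre, h1.succ this, ?_, fun j s' hj h => ?_⟩
      · rw [List.append_nil] at hx ⊢
        exact set_eq_self hx
      -- The head has just moved to the last letter, so nothing lies to its right.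
      · rw [List.getElem?_eq_none (by simpa [LBM.moveHead] using hj)] at h
        cases h
  | back =>
    obtain ⟨n, ts, h1, rfl⟩ := h
    exact ⟨n, ts, h1, set_eq_self hx⟩
  | restart =>
    obtain ⟨n, ts, h1, rfl⟩ := h
    obtain ⟨rfl, -⟩ | ⟨_, _, _, _, h⟩ | ⟨-, h⟩ := writerTape_cases hx
    · exact ⟨n, _, [], _, h1, set_eq_self hx, rfl, fun ts h => h⟩
    · cases h
    · cases h
  | @check s hb =>
    obtain ⟨n, ts, h1, rfl, h2⟩ := h
    refine ⟨n, ts, h1, set_eq_self hx, fun j s' hj hs => ?_⟩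
    obtain ⟨-, h⟩ | ⟨i, z, rfl, hz, h⟩ | ⟨-, h⟩ := writerTape_cases hx
    · cases h
    · cases h
      rcases Nat.lt_or_ge i j with hj' | hj'
      · exact h2 j s' hj' hs
      · obtain rfl : j = i := by simp [LBM.moveHead] at hj; omega
        rw [List.getElem?_map, hs] at hz
        cases hz
        exact hb
    · cases h
  | accept =>
    obtain ⟨n, ts, h1, rfl, h2⟩ := h
    refine ⟨n, ts, h1, fun s hs => ?_⟩
    obtain ⟨j, hj⟩ := List.mem_iff_getElem?.1 hs
    obtain ⟨rfl, -⟩ | ⟨_, _, _, _, h⟩ | ⟨-, h⟩ := writerTape_cases hx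
    · exact h2 j s (Nat.zero_le _) hj
    · cases h
    · cases h

theorem accepts_of_writer {w : List A} (h : w ∈ (D.writer e).language) : ∃ n, D.Accepts w n := by
  obtain ⟨ds, c, hr, hc⟩ := h
  have key : ∀ c c' ds, (D.writer e).Run c ds c' → WriterInv w c → WriterInv w c' := by
    intro c c' ds h
    induction h with
    | nil => exact id
    | cons hs _ ih => exact fun h => ih (h.step hs)
  have := key _ _ _ hr (by
    rw [writer_init]
    exact ⟨0, _, [], _, .zero, rfl, rfl, fun ts h => h⟩)
  obtain ⟨q, h, t⟩ := c
  obtain rfl : q = .done := hc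
  obtain ⟨n, ts, h1, h2⟩ := this
  exact ⟨n, h1.accepts h2⟩

theorem writer_step {p q : WriterState D.Symbol} {x y d} {h h' : ℕ}
    {t t' : List (Cell (Option (B ⊕ D.Symbol)))}
    (hx : t[h]? = some x) (ht : D.WriterTrans e p x q y d) (hh : h' = LBM.moveHead h d)
    (ht' : t' = t.set h y) : (D.writer e).Step ⟨p, h, t⟩ d ⟨q, h', t'⟩ :=
  ⟨x, y, hx, ht, hh, ht'⟩

theorem writer_step_read {p q : WriterState D.Symbol} {x d h t}
    (hx : t[h]? = some x) (ht : D.WriterTrans e p x q x d) :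
    (D.writer e).Step ⟨p, h, t⟩ d ⟨q, LBM.moveHead h d, t⟩ :=
  ⟨x, x, hx, ht, rfl, (set_eq_self hx).symm⟩

theorem writer_run_write {o : Option D.Symbol} {pre : List D.Symbol} {rest ts}
    (h : D.RowRel e o rest ts) : ∃ s, D.right s ∧ (D.writer e).Run
      ⟨.write o, pre.length + 1, writerTape (pre.map .inr ++ rest)⟩
      (List.replicate rest.length .right)
      ⟨.write (some s), (pre ++ ts).length + 1, writerTape ((pre ++ ts).map .inr)⟩ := by
  induction rest generalizing o pre ts with
  | nil =>
    match o, ts, h with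
    | some s, [], h =>
      refine ⟨s, h, ?_⟩
      rw [List.append_nil, List.append_nil]
      exact .nil _
  | cons z rest ih =>
    rcases ts with _ | ⟨t, ts⟩
    · rcases o with _ | _ <;> exact h.elim
    · obtain ⟨h1, h2, h3⟩ := rowRel_cons.1 h
      obtain ⟨s, hs, hr⟩ := ih (pre := pre ++ [t]) h3
      rw [List.append_assoc] at hr
      refine ⟨s, hs, .cons (writer_step (writerTape_succ (z := z) (by simp)) (.write h1 h2)
        (by simp [LBM.moveHead]) ?_) hr⟩
      refine Eq.trans ?_ (writerTape_set _ (by simp) _).symm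
      simp

theorem writer_run_back {zs : List (B ⊕ D.Symbol)} {h : ℕ} (hh : h ≤ zs.length) :
    (D.writer e).Run ⟨.back, h, writerTape zs⟩ (List.replicate h .left)
      ⟨.back, 0, writerTape zs⟩ := by
  induction h with
  | zero => exact .nil _
  | succ h ih =>
    have hx := writerTape_succ (List.getElem?_eq_getElem hh)
    exact .cons (writer_step_read hx .back) (ih (by omega))

theorem writer_run_check {ts : List D.Symbol} (hb : ∀ s ∈ ts, D.bot s) {h : ℕ}
    (hh : h ≤ ts.length) : (D.writer e).Run ⟨.check, h, writerTape (ts.map .inr)⟩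
      (List.replicate h .left) ⟨.check, 0, writerTape (ts.map .inr)⟩ := by
  induction h with
  | zero => exact .nil _
  | succ h ih =>
    have hx := writerTape_succ (B := B) (zs := ts.map .inr) (j := h) (z := .inr ts[h]) (by simp)
    exact .cons (writer_step_read hx (.check (hb _ (List.getElem_mem _))))
      (ih (by omega))

/-- A row consists of a pass to the right, a pass back to the left marker, and one move to the
right. None contains a reversal, and each of the three junctions adds at most one, so four per row
is ample. -/
theorem Rows.exists_run {w : List A} {n : ℕ} {zs} (h : D.Rows e w n zs) :
    ∃ ds, (D.writer e).Run ((D.writer e).init w) ds ⟨.write none, 1, writerTape zs⟩ ∧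
      LBM.reversals ds ≤ 4 * n := by
  induction h with
  | zero => exact ⟨[], by rw [writer_init]; exact .nil _, Nat.zero_le _⟩
  | @succ n zs ts _ hr ih =>
    obtain ⟨ds, h1, h2⟩ := ih
    obtain ⟨s, hs, h3⟩ := writer_run_write (pre := []) hr
    have hx := writerTape_length (ts.map (.inr : _ → B ⊕ D.Symbol))
    rw [List.length_map] at hx
    have h4 : (D.writer e).Run ⟨.write (some s), ts.length + 1, writerTape (ts.map .inr)⟩
        (List.replicate (ts.length + 1) .left) ⟨.back, 0, writerTape (ts.map .inr)⟩ :=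
      .cons (writer_step_read hx (.turn hs)) (writer_run_back (by simp [LBM.moveHead]))
    have h5 : (D.writer e).Run ⟨.back, 0, writerTape (ts.map .inr)⟩
        (List.replicate 1 .right) ⟨.write none, 1, writerTape (ts.map .inr)⟩ :=
      .cons (writer_step_read (writerTape_zero _) .restart) (.nil _)
    refine ⟨_, ((h1.append h3).append h4).append h5, ?_⟩
    have := LBM.reversals_append_le (ds ++ List.replicate zs.length .right ++
      List.replicate (ts.length + 1) .left) (List.replicate 1 .right)
    have := LBM.reversals_append_le (ds ++ List.replicate zs.length .right)
      (List.replicate (ts.length + 1) .left)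
    have := LBM.reversals_append_le ds (List.replicate zs.length .right)
    simp only [LBM.reversals_replicate] at *
    omega

/-- All rows but the last are handled by `Rows.exists_run`; on the last one the machine returns by
checking the bottom condition, which again has three junctions. -/
theorem Accepts.exists_writer_run {w : List A} {n : ℕ} (h : D.Accepts w n) :
    ∃ ds, (D.writer e).AcceptsVia w ds ∧ LBM.reversals ds ≤ 4 * n + 3 := by
  obtain ⟨hw, f, hf⟩ := h
  have hrows := hf.rows (e := e) hw le_rfl
  have hb : ∀ s ∈ (List.range w.length).map (f n), D.bot s := by
    intro s hs
    obtain ⟨j, hj, rfl⟩ := List.mem_map.1 hs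
    exact hf.bot j (List.mem_range.1 hj)
  generalize (List.range w.length).map (f n) = ts at hrows hb
  obtain ⟨zs, hrows, hr⟩ := hrows.exists_pred
  obtain ⟨ds, h1, h2⟩ := hrows.exists_run
  obtain ⟨s, hs, h3⟩ := writer_run_write (pre := []) hr
  have hx := writerTape_length (ts.map (.inr : _ → B ⊕ D.Symbol))
  rw [List.length_map] at hx
  have h4 : (D.writer e).Run ⟨.write (some s), ts.length + 1, writerTape (ts.map .inr)⟩
      (List.replicate (ts.length + 1) .left) ⟨.check, 0, writerTape (ts.map .inr)⟩ :=
    .cons (writer_step_read hx (.turnCheck hs)) (writer_run_check hb le_rfl)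
  have h5 : (D.writer e).Run ⟨.check, 0, writerTape (ts.map .inr)⟩
      (List.replicate 1 .stay) ⟨.done, 0, writerTape (ts.map .inr)⟩ :=
    .cons (writer_step_read (writerTape_zero _) .accept) (.nil _)
  refine ⟨_, ⟨_, ((h1.append h3).append h4).append h5, rfl⟩, ?_⟩
  have := LBM.reversals_append_le (ds ++ List.replicate zs.length .right ++
    List.replicate (ts.length + 1) .left) (List.replicate 1 .stay)
  have := LBM.reversals_append_le (ds ++ List.replicate zs.length .right)
    (List.replicate (ts.length + 1) .left)
  have := LBM.reversals_append_le ds (List.replicate zs.length .right)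
  simp only [LBM.reversals_replicate] at *
  omega

end

end DominoSystem

theorem AcceptedByDominoes.acceptedByLinearReversalLBM {A : Type*} [Finite A] {L : Language A}
    (h : AcceptedByDominoes L) : AcceptedByLinearReversalLBM L := by
  obtain ⟨D, c, h1, h2⟩ := h
  have hL : (D.writer (Finite.equivFin A)).language = L := by
    ext w
    refine ⟨fun h => ?_, fun hw => ?_⟩
    · obtain ⟨n, h⟩ := DominoSystem.accepts_of_writer h
      exact h1 w n h
    · obtain ⟨n, -, h⟩ := h2 w hw
      obtain ⟨ds, h, -⟩ := h.exists_writer_run (e := Finite.equivFin A)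
      exact ⟨ds, h⟩
  refine ⟨D.writer (Finite.equivFin A), 4 * c + 3, fun w hw => ?_, hL⟩
  rw [hL] at hw
  obtain ⟨n, hn, h⟩ := h2 w hw
  obtain ⟨ds, hds, hr⟩ := h.exists_writer_run (e := Finite.equivFin A)
  refine ⟨ds, hds, hr.trans ?_⟩
  have := List.length_pos_iff.2 h.1
  show 4 * n + 3 ≤ (4 * c + 3) * w.length
  nlinarith

/-! ### Sweeps of linearly bounded machines -/

theorem Cell.finite (Γ : Type) [Finite Γ] : Finite (Cell Γ) := by
  refine Finite.of_injective (β := Option (Option Γ))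
    (fun x => match x with
      | .leftEnd => none
      | .rightEnd => some none
      | .letter x => some (some x)) ?_
  rintro (_ | _ | _) (_ | _ | _) <;> simp

namespace LBM

variable {A : Type*} (M : LBM A)

/-- The configuration with tape `t 0, …, t (W - 1)`. -/
def cfg (W : ℕ) (q : M.State) (h : ℕ) (t : ℕ → Cell M.Symbol) : M.Config :=
  ⟨q, h, (List.range W).map t⟩

/-- Sequences of stationary moves, on a cell. -/
def Stays : M.State × Cell M.Symbol → M.State × Cell M.Symbol → Prop :=
  Relation.ReflTransGen fun a b => M.trans a.1 a.2 b.1 b.2 .stay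

/-- The move in a direction, `true` being the direction to the right. -/
def dirMove (d : Bool) : Move := if d then .right else .left

/-- Sequences of stationary moves, on a cell, followed by a move in direction `d`. -/
def Visit (d : Bool) (p : M.State) (x : Cell M.Symbol) (q : M.State) (y : Cell M.Symbol) : Prop :=
  ∃ a, M.Stays (p, x) a ∧ M.trans a.1 a.2 q y (dirMove d)

/-- The position `h'` is next to the position `h` in direction `d`. -/
def Adj (d : Bool) (h h' : ℕ) : Prop := if d then h' = h + 1 else h = h' + 1

variable {M}

/-! ### Computations as chains of sweeps -/

theorem moveHead_dirMove {d : Bool} {h h' : ℕ} (hh : Adj d h h') :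
    moveHead h (dirMove d) = h' := by
  cases d <;> simp [Adj, dirMove, moveHead] at * <;> omega

theorem range_map_set {α : Type*} (W h : ℕ) (t : ℕ → α) (y : α) :
    ((List.range W).map t).set h y = (List.range W).map (Function.update t h y) := by
  apply List.ext_getElem
  · simp
  · intro i h1 h2
    simp only [List.getElem_set, List.getElem_map, List.getElem_range, Function.update_apply]
    by_cases hi : h = i
    · simp [hi]
    · simp [hi, Ne.symm hi]

theorem step_cfg_iff {W h : ℕ} {p : M.State} {t : ℕ → Cell M.Symbol} {d : Move} {c' : M.Config} :
    M.Step (M.cfg W p h t) d c' ↔ h < W ∧ ∃ q y, M.trans p (t h) q y d ∧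
      c' = M.cfg W q (moveHead h d) (Function.update t h y) := by
  constructor
  · rintro ⟨x, y, hx, ht, hh, htape⟩
    simp only [cfg, List.getElem?_map, Option.map_eq_some_iff, List.getElem?_eq_some_iff,
      List.length_range, List.getElem_range] at hx
    obtain ⟨_, ⟨h1, rfl⟩, rfl⟩ := hx
    refine ⟨h1, c'.state, y, ht, ?_⟩
    obtain ⟨q, h', t'⟩ := c'
    dsimp only at hh htape
    rw [cfg, ← range_map_set, hh, htape]
    rfl
  · rintro ⟨h1, q, y, ht, rfl⟩
    refine ⟨t h, y, ?_, ht, rfl, (range_map_set W h t y).symm⟩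
    simp [cfg, h1]

variable (M) in
/-- Computations whose moves are stationary or in direction `d`, by cells visited. -/
inductive Sweep (d : Bool) (W : ℕ) : M.State → ℕ → (ℕ → Cell M.Symbol) →
    M.State → ℕ → (ℕ → Cell M.Symbol) → Prop
  | halt {p q h t y} : h < W → M.Stays (p, t h) (q, y) →
      Sweep d W p h t q h (Function.update t h y)
  | go {p q h h' t y q₂ h₂ t₂} : h < W → M.Visit d p (t h) q y → Adj d h h' →
      Sweep d W q h' (Function.update t h y) q₂ h₂ t₂ → Sweep d W p h t q₂ h₂ t₂

theorem Stays.exists_run {a b : M.State × Cell M.Symbol} (hs : M.Stays a b) {W h : ℕ} (hh : h < W)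
    {t : ℕ → Cell M.Symbol} (ht : t h = a.2) :
    ∃ ds, M.Run (M.cfg W a.1 h t) ds (M.cfg W b.1 h (Function.update t h b.2)) := by
  induction hs using Relation.ReflTransGen.head_induction_on generalizing t with
  | refl => exact ⟨[], by rw [← ht, Function.update_eq_self]; exact .nil _⟩
  | @head a c hac _ ih =>
    obtain ⟨ds, hr⟩ := ih (t := Function.update t h c.2) (by simp)
    rw [Function.update_idem] at hr
    exact ⟨_ :: ds, .cons (step_cfg_iff.2 ⟨hh, _, _, by rw [ht]; exact hac, rfl⟩) hr⟩

theorem Sweep.exists_run {d : Bool} {W : ℕ} {p h t q h' t'} (hs : M.Sweep d W p h t q h' t') :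
    ∃ ds, M.Run (M.cfg W p h t) ds (M.cfg W q h' t') := by
  induction hs with
  | halt hh hs => exact hs.exists_run hh rfl
  | @go p q h h' t y q₂ h₂ t₂ hh hv hadj _ ih =>
    obtain ⟨⟨p', x⟩, hs, ht⟩ := hv
    obtain ⟨ds, hr⟩ := ih
    obtain ⟨ds', hr'⟩ := hs.exists_run hh (t := t) rfl
    have hstep := (step_cfg_iff (M := M) (W := W) (h := h) (p := p')
      (t := Function.update t h x) (d := dirMove d)).2 ⟨hh, q, y, by simpa using ht, rfl⟩
    rw [Function.update_idem, moveHead_dirMove hadj] at hstep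
    exact ⟨ds' ++ _ :: ds, hr'.append (.cons hstep hr)⟩

theorem Sweep.stay {d : Bool} {W : ℕ} {p h t q y q' h' t'} (ht : M.trans p (t h) q y .stay)
    (hs : M.Sweep d W q h (Function.update t h y) q' h' t') : M.Sweep d W p h t q' h' t' := by
  generalize hu : Function.update t h y = u at hs
  cases hs with
  | @halt _ _ _ _ y' hh hs =>
    subst hu
    rw [Function.update_self] at hs
    rw [Function.update_idem]
    exact .halt hh (.head ht hs)
  | go hh hv hadj hs =>
    subst hu
    rw [Function.update_self] at hv
    rw [Function.update_idem] at hs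
    obtain ⟨a, ha, hv⟩ := hv
    exact .go hh ⟨a, .head ht ha, hv⟩ hadj hs

theorem Sweep.refl {d : Bool} {W : ℕ} {p : M.State} {h : ℕ} {t : ℕ → Cell M.Symbol} (hh : h < W) :
    M.Sweep d W p h t p h t := by
  simpa using Sweep.halt (d := d) (p := p) (t := t) hh .refl

variable (M) in
/-- Sequences of `n + 1` sweeps, the first one in direction `d`. -/
inductive Chain (W : ℕ) : Bool → ℕ → M.State → ℕ → (ℕ → Cell M.Symbol) →
    M.State → ℕ → (ℕ → Cell M.Symbol) → Prop
  | one {d p h t q h' t'} : M.Sweep d W p h t q h' t' → Chain W d 0 p h t q h' t'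
  | cons {d d' n p h t q h' t' q₂ h₂ t₂} : M.Sweep d W p h t q h' t' →
      Chain W d' n q h' t' q₂ h₂ t₂ → Chain W d (n + 1) p h t q₂ h₂ t₂

theorem Chain.prepend {W : ℕ} {d n p h t q h' t' q₂ h₂ t₂}
    (hc : M.Chain W d n q h' t' q₂ h₂ t₂)
    (hp : ∀ {q₃ h₃ t₃}, M.Sweep d W q h' t' q₃ h₃ t₃ → M.Sweep d W p h t q₃ h₃ t₃) :
    M.Chain W d n p h t q₂ h₂ t₂ := by
  cases hc with
  | one hs => exact .one (hp hs)
  | cons hs hc => exact .cons (hp hs) hc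

/-- The tape is delimited by end markers, and the head is on it. -/
def Delimited (W h : ℕ) (t : ℕ → Cell M.Symbol) : Prop :=
  t 0 = .leftEnd ∧ t (W - 1) = .rightEnd ∧ h < W

/-- The end markers keep the head on the tape; in particular a left move never occurs at position
`0`, where the subtraction in `moveHead` would be truncated. -/
theorem Delimited.step {W h : ℕ} {t : ℕ → Cell M.Symbol} (hd : Delimited W h t) {p q y d}
    (ht : M.trans p (t h) q y d) :
    Delimited W (moveHead h d) (Function.update t h y) ∧ (d = .left → 0 < h) := by
  obtain ⟨h0, h1, hh⟩ := hd
  have hl : h = 0 → y = .leftEnd ∧ d ≠ .left := by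
    rintro rfl
    rw [h0] at ht
    exact M.trans_leftEnd _ _ _ _ ht
  have hr : h = W - 1 → y = .rightEnd ∧ d ≠ .right := by
    rintro rfl
    rw [h1] at ht
    exact M.trans_rightEnd _ _ _ _ ht
  refine ⟨⟨?_, ?_, ?_⟩, ?_⟩
  · rw [Function.update_apply]
    split_ifs with h
    · exact (hl h.symm).1
    · exact h0
  · rw [Function.update_apply]
    split_ifs with h
    · exact (hr h.symm).1
    · exact h1
  · cases d
    · simp only [moveHead]; omega
    · exact hh
    · have : h ≠ W - 1 := fun h => (hr h).2 rfl
      simp only [moveHead]; omega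
  · rintro rfl
    exact Nat.pos_of_ne_zero fun h => (hl h).2 rfl

theorem changes_cons {a : Move} {ds : List Move} (h : ds.head? = none ∨ ds.head? = some a) :
    changes (a :: ds) = changes ds := by
  rcases ds with _ | ⟨b, ds⟩
  · rfl
  · obtain rfl : b = a := by simpa using h
    simp [changes]

theorem changes_cons_of_ne {a b : Move} {ds : List Move} (h : ds.head? = some b) (hab : a ≠ b) :
    changes (a :: ds) = changes ds + 1 := by
  rcases ds with _ | ⟨c, ds⟩
  · cases h
  · obtain rfl : c = b := by simpa using h
    simp [changes, hab, add_comm]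

/-- By induction from the first step: it extends the first sweep of the remaining computation unless
the next nonstationary move is opposite, which is a reversal and opens a new sweep. The direction is
left free when all moves are stationary, so that any step can be put in front. -/
theorem Run.exists_chain {W : ℕ} {c c' : M.Config} {ds : List Move} (hr : M.Run c ds c')
    {p : M.State} {h : ℕ} {t : ℕ → Cell M.Symbol} (hc : c = M.cfg W p h t) (hd : Delimited W h t) :
    ∃ q h' t', c' = M.cfg W q h' t' ∧ ∀ d : Bool,
      ((ds.filter (fun d => d ≠ .stay)).head? = none ∨
        (ds.filter (fun d => d ≠ .stay)).head? = some (dirMove d)) →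
      M.Chain W d (reversals ds) p h t q h' t' := by
  induction hr generalizing p h t with
  | nil => exact ⟨p, h, t, hc, fun d _ => .one (.refl hd.2.2)⟩
  | @cons c c₁ c' m ds hs _ ih =>
    subst hc
    obtain ⟨hh, q, y, ht, rfl⟩ := step_cfg_iff.1 hs
    obtain ⟨hd', hleft⟩ := hd.step ht
    obtain ⟨q', h', t', hc', ih⟩ := ih rfl hd'
    refine ⟨q', h', t', hc', fun d hm => ?_⟩
    by_cases hst : m = .stay
    · subst hst
      have hf : (Move.stay :: ds).filter (fun d => d ≠ .stay) = ds.filter (fun d => d ≠ .stay) := by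
        simp
      rw [hf] at hm
      rw [reversals, hf]
      exact (ih d hm).prepend (.stay ht)
    · have hf : (m :: ds).filter (fun d => d ≠ .stay) = m :: ds.filter (fun d => d ≠ .stay) := by
        simp [hst]
      rw [hf] at hm
      obtain rfl : m = dirMove d := by simpa using hm
      rw [reversals, hf]
      have hadj : Adj d h (moveHead h (dirMove d)) := by
        cases d
        · have := hleft rfl
          simp only [Adj, dirMove, moveHead, Bool.false_eq_true, if_false]; omega
        · simp [Adj, dirMove, moveHead]
      have hgo : ∀ {q₃ h₃ t₃}, M.Sweep d W q (moveHead h (dirMove d)) (Function.update t h y)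
          q₃ h₃ t₃ → M.Sweep d W p h t q₃ h₃ t₃ := fun hs => .go hh ⟨_, .refl, ht⟩ hadj hs
      by_cases hsame : (ds.filter (fun d => d ≠ .stay)).head? = none ∨
        (ds.filter (fun d => d ≠ .stay)).head? = some (dirMove d)
      · rw [changes_cons hsame]
        exact (ih d hsame).prepend hgo
      · have hopp : (ds.filter (fun d => d ≠ .stay)).head? = some (dirMove !d) := by
          rw [not_or] at hsame
          obtain ⟨b, hb⟩ := Option.ne_none_iff_exists'.1 hsame.1
          rw [hb] at hsame ⊢
          have hb' : b ≠ .stay := by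
            have := List.mem_of_mem_head? hb
            simpa using (List.mem_filter.1 this).2
          cases d <;> cases b <;> simp_all [dirMove]
        rw [changes_cons_of_ne hopp (by cases d <;> simp [dirMove])]
        -- A sweep made of this single move is put before the chain that starts in the opposite
        -- direction.
        exact .cons (hgo (.refl hd'.2.2)) (ih (!d) (.inr hopp))

/-! ### Sweeps as rows of local conditions -/

/-- The presence of the head in state `q` and position `h`. -/
def headAt {Q : Type} (h : ℕ) (q : Q) (x : ℕ) : Option Q := if x = h then some q else none

variable (M) in
/-- The local condition on a cell during a sweep in direction `d`: its contents `x` and `y` and the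
state of the head there, before and after the sweep, and the states `i` and `o` in which the head
enters and leaves it. -/
inductive CellSweep (d : Bool) : Cell M.Symbol → Option M.State → Option M.State →
    Option M.State → Cell M.Symbol → Option M.State → Prop
  | idle {x} : CellSweep d x none none none x none
  | halt {x a i p q y} : (a = some p ∧ i = none ∨ a = none ∧ i = some p) →
      M.Stays (p, x) (q, y) → CellSweep d x a i none y (some q)
  | go {x a i p q y} : (a = some p ∧ i = none ∨ a = none ∧ i = some p) →
      M.Visit d p x q y → CellSweep d x a i (some q) y none

/-- A visit is the same whether the head starts on the cell or enters it; this allows the start of a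
sweep to be shifted by one cell. -/
theorem CellSweep.swap {d : Bool} {x p o y b} (h : M.CellSweep d x (some p) none o y b) :
    M.CellSweep d x none (some p) o y b := by
  cases h with
  | halt h hs => simp at h; exact .halt (.inr ⟨rfl, rfl⟩) (h ▸ hs)
  | go h hs => simp at h; exact .go (.inr ⟨rfl, rfl⟩) (h ▸ hs)

theorem CellSweep.swap' {d : Bool} {x p o y b} (h : M.CellSweep d x none (some p) o y b) :
    M.CellSweep d x (some p) none o y b := by
  cases h with
  | halt h hs => simp at h; exact .halt (.inl ⟨rfl, rfl⟩) (h ▸ hs)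
  | go h hs => simp at h; exact .go (.inl ⟨rfl, rfl⟩) (h ▸ hs)

theorem CellSweep.eq_of_none {d : Bool} {x o y b} (h : M.CellSweep d x none none o y b) :
    o = none ∧ y = x ∧ b = none := by
  cases h with
  | idle => exact ⟨rfl, rfl, rfl⟩
  | halt h _ => simp at h
  | go h _ => simp at h

/-- The boundary by which a sweep in direction `d` enters the cell `x`. -/
def entry (d : Bool) (x : ℕ) : ℕ := if d then x else x + 1

/-- The boundary by which a sweep in direction `d` leaves the cell `x`. -/
def exit (d : Bool) (x : ℕ) : ℕ := if d then x + 1 else x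

theorem Adj.entry_eq {d : Bool} {x y : ℕ} (h : Adj d x y) : entry d y = exit d x := by
  cases d <;> simp [Adj, entry, exit] at * <;> omega

theorem entry_inj {d : Bool} {x y : ℕ} : entry d x = entry d y ↔ x = y := by
  cases d <;> simp [entry]

theorem exit_inj {d : Bool} {x y : ℕ} : exit d x = exit d y ↔ x = y := by
  cases d <;> simp [exit]

/-- The position `y` is strictly after the position `x` in direction `d`. -/
def After (d : Bool) (x y : ℕ) : Prop := if d then x < y else y < x

theorem Adj.after {d : Bool} {x y : ℕ} (h : Adj d x y) : After d x y := by
  cases d <;> simp [Adj, After] at * <;> omega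

theorem After.trans {d : Bool} {x y z : ℕ} (h : After d x y) (h' : After d y z) :
    After d x z := by
  cases d <;> simp [After] at * <;> omega

theorem After.ne {d : Bool} {x y : ℕ} (h : After d x y) : x ≠ y := by
  cases d <;> simp [After] at * <;> omega

theorem Sweep.lt {d : Bool} {W : ℕ} {p h t q h' t'} (hs : M.Sweep d W p h t q h' t') :
    h < W := by
  cases hs with
  | halt hh _ => exact hh
  | go hh _ _ _ => exact hh

theorem exit_ne {d : Bool} {W x y : ℕ} (h : Adj d x y) (hx : x < W) (hy : y < W) :
    exit d x ≠ 0 ∧ exit d x ≠ W := by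
  cases d <;> simp [Adj, exit] at * <;> omega

/-- `B` gives the state in which the head crosses each boundary. A sweep crosses a boundary at most
once, and never one behind its start, so the first crossing can be added to the `B` of the remaining
sweep. The clauses with `After` carry this through the induction. -/
theorem Sweep.exists_row {d : Bool} {W : ℕ} {p h t q h' t'} (hs : M.Sweep d W p h t q h' t') :
    ∃ B : ℕ → Option M.State, B 0 = none ∧ B W = none ∧ (∀ x, ¬ After d h x → B (entry d x) = none) ∧
      (h' = h ∨ After d h h') ∧
      ∀ x < W, M.CellSweep d (t x) (headAt h p x) (B (entry d x)) (B (exit d x)) (t' x)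
        (headAt h' q x) := by
  induction hs with
  | @halt p q h t y hh hs =>
    refine ⟨fun _ => none, rfl, rfl, fun _ _ => rfl, .inl rfl, fun x _ => ?_⟩
    by_cases hx : x = h
    · subst hx
      simp only [headAt, if_true, Function.update_self]
      exact .halt (.inl ⟨rfl, rfl⟩) hs
    · simp only [headAt, hx, if_false, Function.update_of_ne hx]
      exact .idle
  | @go p q h h₁ t y q₂ h₂ t₂ hh hv hadj hs ih =>
    obtain ⟨B, hB0, hBW, hB, hord, hcell⟩ := ih
    have hlt := hadj.after
    obtain ⟨hne0, hneW⟩ := exit_ne hadj hh hs.lt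
    have hn1 : ¬ After d h₁ h := fun h' => (hlt.trans h').ne rfl
    have hh₂ : After d h h₂ := by
      rcases hord with rfl | h'
      · exact hlt
      · exact hlt.trans h'
    refine ⟨Function.update B (exit d h) (some q), ?_, ?_, ?_, .inr hh₂, ?_⟩
    · rw [Function.update_of_ne hne0.symm, hB0]
    · rw [Function.update_of_ne hneW.symm, hBW]
    · intro x hx
      rw [← hadj.entry_eq, Function.update_of_ne, hB x fun h' => hx (hlt.trans h')]
      rw [ne_eq, entry_inj]
      rintro rfl
      exact hx hlt
    · intro x hxW
      have hc := hcell x hxW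
      by_cases hx : x = h
      · subst hx
        have h1 : B (entry d x) = none := hB x hn1
        rw [Function.update_self, h1, headAt, if_neg hlt.ne] at hc
        obtain ⟨-, h2, -⟩ := hc.eq_of_none
        have h3 : entry d x ≠ exit d x := by
          rw [← hadj.entry_eq, ne_eq, entry_inj]
          exact hlt.ne
        rw [Function.update_self, Function.update_of_ne h3, h1, h2, headAt, headAt, if_pos rfl,
          if_neg hh₂.ne]
        exact .go (.inl ⟨rfl, rfl⟩) hv
      · rw [Function.update_of_ne hx] at hc
        have h3 : exit d x ≠ exit d h := by rwa [ne_eq, exit_inj]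
        rw [Function.update_of_ne h3, headAt, if_neg hx]
        by_cases hx' : x = h₁
        · subst hx'
          rw [hB x fun h' => h'.ne rfl, headAt, if_pos rfl] at hc
          rw [hadj.entry_eq, Function.update_self]
          exact hc.swap
        · rw [headAt, if_neg hx'] at hc
          have h4 : entry d x ≠ exit d h := by
            rw [← hadj.entry_eq, ne_eq, entry_inj]
            exact hx'
          rwa [Function.update_of_ne h4]

/-- A state entering a cell without head must come from the preceding cell in direction `d`; along a
region `I` of such cells, its absence therefore propagates. The induction is on the position
measured in that direction. -/
theorem entry_eq_none_of_idle {d : Bool} {W : ℕ} {t t' : ℕ → Cell M.Symbol}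
    {a B b : ℕ → Option M.State}
    (hcell : ∀ x < W, M.CellSweep d (t x) (a x) (B (entry d x)) (B (exit d x)) (t' x) (b x))
    {I : ℕ → Prop} (h1 : ∀ x < W, I x → a x = none)
    (h2 : ∀ x < W, I x → B (entry d x) = none ∨ ∃ y < W, I y ∧ Adj d y x) :
    ∀ x < W, I x → B (entry d x) = none := by
  have key : ∀ n, ∀ x < W, (if d then x else W - x) = n → I x → B (entry d x) = none := by
    intro n
    induction n using Nat.strong_induction_on with
    | _ n ih =>
      intro x hx hn hI
      rcases h2 x hx hI with h | ⟨y, hy, hIy, hadj⟩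
      · exact h
      · have h3 := ih (if d then y else W - y) (by
          cases d <;> simp [Adj] at * <;> omega) y hy rfl hIy
        have hc := hcell y hy
        rw [h1 y hy hIy, h3] at hc
        rw [hadj.entry_eq]
        exact hc.eq_of_none.1
  exact fun x hx => key _ x hx rfl

/-- No state enters the cells up to the head, so those before it are idle. The cell of the head
either ends the sweep, and then all later cells are idle, or sends a state across its exit; in that
case the argument is repeated with the head on the next cell and this crossing erased from `B`. Each
repetition brings the head nearer to the end of the tape. -/
theorem exists_sweep_of_row {d : Bool} {W : ℕ} {t' : ℕ → Cell M.Symbol} {b : ℕ → Option M.State}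
    {n : ℕ} : ∀ {p : M.State} {h : ℕ} {t : ℕ → Cell M.Symbol} {B : ℕ → Option M.State},
    (if d then W - h else h) = n → h < W → B 0 = none → B W = none →
    (∀ x < W, M.CellSweep d (t x) (headAt h p x) (B (entry d x)) (B (exit d x)) (t' x) (b x)) →
    ∃ q h₂ t₂, h₂ < W ∧ M.Sweep d W p h t q h₂ t₂ ∧ ∀ x < W, t' x = t₂ x ∧ b x = headAt h₂ q x := by
  induction n using Nat.strong_induction_on with
  | _ n ih =>
    intro p h t B hn hh hB0 hBW hcell
    have hpre : ∀ x < W, ¬ After d h x → B (entry d x) = none := by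
      have hbefore : ∀ x < W, After d x h → B (entry d x) = none := by
        refine entry_eq_none_of_idle (I := fun x => After d x h) hcell ?_ ?_
        · intro x _ hx
          rw [headAt, if_neg hx.ne]
        · intro x hx hI
          cases d
          · by_cases hx' : x + 1 < W
            · refine .inr ⟨x + 1, hx', ?_, ?_⟩ <;> simp [After, Adj] at * <;> omega
            · obtain rfl : W = x + 1 := by omega
              exact .inl hBW
          · rcases x with _ | x
            · exact .inl hB0
            · refine .inr ⟨x, by omega, ?_, ?_⟩ <;> simp [After, Adj] at * <;> omega
      intro x hx hax
      by_cases hxh : x = h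
      · subst hxh
        cases d
        · by_cases hx' : x + 1 < W
          · have h1 := hbefore (x + 1) hx' (by simp [After])
            have hc := hcell (x + 1) hx'
            rw [h1, headAt, if_neg (by omega)] at hc
            exact hc.eq_of_none.1
          · obtain rfl : W = x + 1 := by omega
            exact hBW
        · rcases x with _ | x
          · exact hB0
          · have h1 := hbefore x (by omega) (by simp [After])
            have hc := hcell x (by omega)
            rw [h1, headAt, if_neg (by omega)] at hc
            exact hc.eq_of_none.1
      · refine hbefore x hx ?_
        cases d <;> simp [After] at * <;> omega
    have hc := hcell h hh
    rw [hpre h hh fun h' => h'.ne rfl, headAt, if_pos rfl] at hc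
    have hidle : ∀ x < W, After d x h → t' x = t x ∧ b x = none := by
      intro x hx hx'
      have hc := hcell x hx
      rw [hpre x hx fun h' => (hx'.trans h').ne rfl, headAt, if_neg hx'.ne] at hc
      exact hc.eq_of_none.2
    generalize ho : B (exit d h) = o at hc
    generalize hy : t' h = y at hc
    generalize hbh : b h = bh at hc
    cases hc with
    | @halt _ _ p' q _ hp hs =>
      obtain rfl : p = p' := by simpa using hp
      have hafter : ∀ x < W, After d h x → B (entry d x) = none := by
        refine entry_eq_none_of_idle (I := fun x => After d h x) hcell ?_ ?_
        · intro x _ hx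
          rw [headAt, if_neg hx.ne.symm]
        · intro x hx hI
          by_cases hadj : Adj d h x
          · rw [hadj.entry_eq, ho]; exact .inl rfl
          · refine .inr ?_
            cases d
            · refine ⟨x + 1, ?_, ?_, ?_⟩ <;> simp [After, Adj] at * <;> omega
            · refine ⟨x - 1, ?_, ?_, ?_⟩ <;> simp [After, Adj] at * <;> omega
      refine ⟨q, h, Function.update t h y, hh, .halt hh hs, fun x hx => ?_⟩
      by_cases hxh : x = h
      · subst hxh
        rw [Function.update_self, headAt, if_pos rfl]
        exact ⟨hy, hbh⟩
      · have hc := hcell x hx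
        have hB : B (entry d x) = none := by
          by_cases h' : After d h x
          · exact hafter x hx h'
          · exact hpre x hx h'
        rw [hB, headAt, if_neg hxh] at hc
        rw [Function.update_of_ne hxh, headAt, if_neg hxh]
        exact hc.eq_of_none.2
    | @go _ _ p' q _ hp hv =>
      obtain rfl : p = p' := by simpa using hp
      -- The head cannot leave the tape, since `B` vanishes at its two ends.
      obtain ⟨h₁, hh₁, hadj⟩ : ∃ h₁ < W, Adj d h h₁ := by
        cases d
        · rcases h with _ | h
          · simp [exit, hB0] at ho
          · exact ⟨h, by omega, by simp [Adj]⟩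
        · by_cases hx' : h + 1 < W
          · exact ⟨h + 1, hx', by simp [Adj]⟩
          · obtain rfl : W = h + 1 := by omega
            simp [exit, hBW] at ho
      have hlt := hadj.after
      obtain ⟨hne0, hneW⟩ := exit_ne hadj hh hh₁
      obtain ⟨q₂, h₂, t₂, h2, hs, hrow⟩ := ih (if d then W - h₁ else h₁)
        (by cases d <;> simp [Adj] at * <;> omega) (p := q) (h := h₁) (t := Function.update t h y)
        (B := Function.update B (exit d h) none) rfl hh₁
        (by rw [Function.update_of_ne hne0.symm, hB0])
        (by rw [Function.update_of_ne hneW.symm, hBW]) (by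
          intro x hx
          by_cases hxh : x = h
          · subst hxh
            have h3 : entry d x ≠ exit d x := by
              rw [← hadj.entry_eq, ne_eq, entry_inj]
              exact hlt.ne
            rw [Function.update_self, Function.update_self, Function.update_of_ne h3,
              hpre x hx fun h' => h'.ne rfl, headAt, if_neg hlt.ne, hy, hbh]
            exact .idle
          · have hc := hcell x hx
            have h3 : exit d x ≠ exit d h := by rwa [ne_eq, exit_inj]
            rw [headAt, if_neg hxh] at hc
            rw [Function.update_of_ne hxh, Function.update_of_ne h3]
            by_cases hx' : x = h₁
            · subst hx'
              rw [hadj.entry_eq, ho] at hc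
              rw [hadj.entry_eq, Function.update_self, headAt, if_pos rfl]
              exact hc.swap'
            · have h4 : entry d x ≠ exit d h := by
                rw [← hadj.entry_eq, ne_eq, entry_inj]
                exact hx'
              rwa [Function.update_of_ne h4, headAt, if_neg hx'])
      exact ⟨q₂, h₂, t₂, h2, .go hh hv hadj hs, hrow⟩

end LBM

/-! ### From linearly bounded machines to domino systems over tapes -/

/-- A cell of the array whose rows are the sweeps of a computation: the direction of the sweep, the
contents of the tape cell and the state of the head there, before and after the sweep, and the
states in which the head crosses its left and right boundaries. The field `first` marks the cells
of the first row. -/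
structure SweepCell (Q Γ : Type) where
  first : Bool
  dir : Bool
  old : Cell Γ
  new : Cell Γ
  oldHead : Option Q
  newHead : Option Q
  left : Option Q
  right : Option Q

theorem SweepCell.finite (Q Γ : Type) [Finite Q] [Finite Γ] : Finite (SweepCell Q Γ) := by
  have := Cell.finite Γ
  refine Finite.of_injective
    (fun s => (s.first, s.dir, s.old, s.new, s.oldHead, s.newHead, s.left, s.right)) ?_
  rintro ⟨⟩ ⟨⟩ h
  simpa using h

namespace LBM

variable {A : Type*} (M : LBM A)

/-- The local condition on the cells of the rows that are sweeps of `M`. -/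
def ValidCell (s : SweepCell M.State M.Symbol) : Prop :=
  M.CellSweep s.dir s.old s.oldHead (if s.dir then s.left else s.right)
    (if s.dir then s.right else s.left) s.new s.newHead

/-- The domino system whose rows are the sweeps of the accepting computations of `M`. -/
def sweepDomino : DominoSystem (Cell M.Symbol) where
  Symbol := {s // M.ValidCell s}
  finite_symbol := by
    have := M.finite_state
    have := M.finite_symbol
    have := SweepCell.finite M.State M.Symbol
    infer_instance
  top a s := s.1.first = true ∧ s.1.old = a
  left s := s.1.left = none ∧ (s.1.first = true → s.1.oldHead = none)
  right s := s.1.right = none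
  bot s := ∀ q, s.1.newHead = some q → q ∈ M.accept
  hor s t := s.1.dir = t.1.dir ∧ s.1.right = t.1.left ∧ (s.1.first = true →
    (s.1.old = .leftEnd → t.1.oldHead = some M.start) ∧ (s.1.old ≠ .leftEnd → t.1.oldHead = none))
  ver s t := s.1.new = t.1.old ∧ s.1.newHead = t.1.oldHead

/-- The contents of the tape with the input `w`, as a function. -/
def inputTape (w : List A) (x : ℕ) : Cell M.Symbol := (M.init w).tape.getD x .leftEnd

variable {M}

theorem inputTape_eq {w : List A} {x : ℕ} (hx : x < (M.init w).tape.length) :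
    M.inputTape w x = (M.init w).tape[x] := by
  simp [inputTape, hx]

theorem init_eq_cfg (w : List A) :
    M.init w = M.cfg (M.init w).tape.length M.start 1 (M.inputTape w) := by
  have h : (M.init w).tape = (List.range (M.init w).tape.length).map (M.inputTape w) := by
    apply List.ext_getElem
    · simp
    · intro x h1 h2
      simp [inputTape_eq h1]
  exact congrArg (Config.mk M.start 1) h

theorem init_tape_length (w : List A) :
    (M.init w).tape.length = (1 + M.extra) * w.length + 2 := by
  simp [init]
  ring

theorem delimited_init (w : List A) :
    Delimited (M.init w).tape.length 1 (M.inputTape w) := by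
  have h := init_tape_length (M := M) w
  refine ⟨rfl, ?_, by omega⟩
  rw [inputTape_eq (by omega)]
  simp only [init, List.length_append, List.length_cons, List.length_nil, zero_add,
    Nat.add_sub_cancel]
  rw [List.getElem_append_right (by simp)]
  simp

/-- The starting position of the head is thus recognized locally, as the cell next to a left marker.
-/
theorem inputTape_ne_leftEnd {w : List A} {x : ℕ} (hx : x + 1 < (M.init w).tape.length) :
    M.inputTape w (x + 1) ≠ .leftEnd := by
  rw [inputTape_eq hx]
  have h : ∀ a ∈ (M.init w).tape.tail, a ≠ .leftEnd := by
    intro a ha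
    simp only [init, List.cons_append, List.nil_append, List.tail_cons,
      List.mem_append, List.mem_map, List.mem_singleton] at ha
    rcases ha with ⟨_, _, rfl⟩ | rfl <;> simp
  refine h _ ?_
  rw [← List.getElem_tail (h := by simp; omega)]
  exact List.getElem_mem _

theorem ite_eq_entry {α : Type*} {d : Bool} {B : ℕ → α} {x : ℕ} :
    (if d then B x else B (x + 1)) = B (entry d x) := by
  cases d <;> rfl

theorem ite_eq_exit {α : Type*} {d : Bool} {B : ℕ → α} {x : ℕ} :
    (if d then B (x + 1) else B x) = B (exit d x) := by
  cases d <;> rfl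

theorem exists_sweep_of_isPicture {T : List (Cell M.Symbol)} {n : ℕ}
    {f : ℕ → ℕ → M.sweepDomino.Symbol} (hf : M.sweepDomino.IsPicture T n f) {i : ℕ} (hi : i ≤ n)
    {q : M.State} {h : ℕ} {t : ℕ → Cell M.Symbol} (hh : h < T.length)
    (hrow : ∀ x < T.length, (f i x).1.old = t x ∧ (f i x).1.oldHead = headAt h q x) :
    ∃ d q' h' t', h' < T.length ∧ M.Sweep d T.length q h t q' h' t' ∧
      ∀ x < T.length, (f i x).1.new = t' x ∧ (f i x).1.newHead = headAt h' q' x := by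
  obtain ⟨B, hB0, hB1⟩ : ∃ B : ℕ → Option M.State, B 0 = (f i 0).1.left ∧
      ∀ x, B (x + 1) = (f i x).1.right :=
    ⟨fun x => Nat.casesOn x (f i 0).1.left fun x => (f i x).1.right, rfl, fun _ => rfl⟩
  have hB : ∀ x < T.length, B x = (f i x).1.left := by
    rintro (_ | x) hx
    · exact hB0
    · rw [hB1]; exact (hf.hor i hi x hx).2.1
  have hdir : ∀ x < T.length, (f i x).1.dir = (f i 0).1.dir := by
    intro x
    induction x with
    | zero => simp
    | succ x ih => exact fun hx => (hf.hor i hi x hx).1.symm.trans (ih (by omega))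
  obtain ⟨q', h', t', hh', hs, hrow'⟩ := exists_sweep_of_row (d := (f i 0).1.dir) (W := T.length)
    (t' := fun x => (f i x).1.new) (b := fun x => (f i x).1.newHead) (p := q) (t := t) (B := B)
    rfl hh (by rw [hB0]; exact (hf.left i hi).1)
    (by
      have := hf.right i hi
      obtain ⟨m, hm⟩ : ∃ m, T.length = m + 1 := ⟨T.length - 1, by omega⟩
      rw [hm, Nat.add_sub_cancel] at this
      rw [hm, hB1]
      exact this)
    (fun x hx => by
      have hv := (f i x).2
      rw [ValidCell, hdir x hx, (hrow x hx).1, (hrow x hx).2, ← hB x hx, ← hB1, ite_eq_entry,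
        ite_eq_exit] at hv
      exact hv)
  exact ⟨_, q', h', t', hh', hs, hrow'⟩

/-- Rows are turned into sweeps from top to bottom, each carrying exactly one head. On the top row
this comes from `first`, which activates the initial conditions hidden in `left` and `hor`: the
start state to the right of the left marker, and no head elsewhere. -/
theorem mem_language_of_sweepDomino {w : List A} {n : ℕ}
    (h : M.sweepDomino.Accepts (M.init w).tape n) : w ∈ M.language := by
  obtain ⟨-, f, hf⟩ := h
  have hlen := init_tape_length (M := M) w
  have key : ∀ i ≤ n, ∃ q h t ds, h < (M.init w).tape.length ∧
      M.Run (M.init w) ds (M.cfg (M.init w).tape.length q h t) ∧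
      ∀ x < (M.init w).tape.length, (f i x).1.old = t x ∧ (f i x).1.oldHead = headAt h q x := by
    intro i
    induction i with
    | zero =>
      refine fun _ => ⟨M.start, 1, M.inputTape w, [], by omega, ?_, fun x hx => ⟨?_, ?_⟩⟩
      · rw [← init_eq_cfg]; exact .nil _
      · rw [inputTape_eq hx]; exact (hf.top x hx).2
      · rcases x with _ | x
        · exact (hf.left 0 (Nat.zero_le _)).2 (hf.top 0 hx).1
        · have htop := hf.top x (by omega)
          have hhor := (hf.hor 0 (Nat.zero_le _) x hx).2.2 htop.1
          rw [htop.2, ← inputTape_eq] at hhor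
          rcases x with _ | x
          · exact hhor.1 rfl
          · rw [headAt, if_neg (by omega)]
            exact hhor.2 (inputTape_ne_leftEnd (by omega))
    | succ i ih =>
      intro hi
      obtain ⟨q, h, t, ds, hh, hr, hrow⟩ := ih (by omega)
      obtain ⟨d, q', h', t', hh', hs, hrow'⟩ := exists_sweep_of_isPicture hf (by omega) hh hrow
      obtain ⟨ds', hr'⟩ := hs.exists_run
      refine ⟨q', h', t', _, hh', hr.append hr', fun x hx => ?_⟩
      rw [← (hf.ver i hi x hx).1, ← (hf.ver i hi x hx).2]
      exact hrow' x hx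
  obtain ⟨q, h, t, ds, hh, hr, hrow⟩ := key n le_rfl
  obtain ⟨d, q', h', t', hh', hs, hrow'⟩ := exists_sweep_of_isPicture hf le_rfl hh hrow
  obtain ⟨ds', hr'⟩ := hs.exists_run
  refine ⟨_, _, hr.append hr', hf.bot h' hh' q' ?_⟩
  rw [(hrow' h' hh').2, headAt, if_pos rfl]

theorem Chain.exists_sequence {W : ℕ} {d n p h t q h' t'} (hc : M.Chain W d n p h t q h' t') :
    ∃ (D : ℕ → Bool) (P : ℕ → M.State) (H : ℕ → ℕ) (T : ℕ → ℕ → Cell M.Symbol),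
      P 0 = p ∧ H 0 = h ∧ T 0 = t ∧ P (n + 1) = q ∧
      ∀ i ≤ n, M.Sweep (D i) W (P i) (H i) (T i) (P (i + 1)) (H (i + 1)) (T (i + 1)) := by
  induction hc with
  | @one d p h t q h' t' hs =>
    refine ⟨fun _ => d, fun i => Nat.casesOn i p fun _ => q, fun i => Nat.casesOn i h fun _ => h',
      fun i => Nat.casesOn i t fun _ => t', rfl, rfl, rfl, rfl, fun i hi => ?_⟩
    obtain rfl : i = 0 := by omega
    exact hs
  | @cons d d' n p h t q h' t' q₂ h₂ t₂ hs _ ih =>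
    obtain ⟨D, P, H, T, rfl, rfl, rfl, hq, hseq⟩ := ih
    refine ⟨fun i => Nat.casesOn i d D, fun i => Nat.casesOn i p P, fun i => Nat.casesOn i h H,
      fun i => Nat.casesOn i t T, rfl, rfl, rfl, hq, fun i hi => ?_⟩
    rcases i with _ | i
    · exact hs
    · exact hseq i (by omega)

/-- Each sweep of the chain gives one row; there is one more sweep than reversals, which matches
rows numbered from `0`. -/
theorem AcceptsVia.sweepDomino_accepts {w : List A} {ds : List Move} (h : M.AcceptsVia w ds) :
    M.sweepDomino.Accepts (M.init w).tape (reversals ds) := by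
  obtain ⟨c, hr, hc⟩ := h
  have hlen := init_tape_length (M := M) w
  obtain ⟨q, h', t', rfl, hchain⟩ := hr.exists_chain (init_eq_cfg w) (delimited_init w)
  obtain ⟨d, hd⟩ : ∃ d : Bool, (ds.filter (fun d => d ≠ .stay)).head? = none ∨
      (ds.filter (fun d => d ≠ .stay)).head? = some (dirMove d) := by
    rcases hm : (ds.filter (fun d => d ≠ .stay)).head? with _ | m
    · exact ⟨true, .inl hm⟩
    · have hm' : m ≠ .stay := by
        have := List.mem_of_mem_head? hm
        simpa using (List.mem_filter.1 this).2
      cases m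
      · exact ⟨false, .inr hm⟩
      · exact absurd rfl hm'
      · exact ⟨true, .inr hm⟩
  obtain ⟨D, P, H, T, hP0, hH0, hT0, hPn, hseq⟩ := (hchain d hd).exists_sequence
  generalize reversals ds = n at hseq hPn
  generalize hW : (M.init w).tape.length = W at hseq
  have hrows : ∀ i, ∃ B : ℕ → Option M.State, i ≤ n → B 0 = none ∧ B W = none ∧
      ∀ x < W, M.CellSweep (D i) (T i x) (headAt (H i) (P i) x) (B (entry (D i) x))
        (B (exit (D i) x)) (T (i + 1) x) (headAt (H (i + 1)) (P (i + 1)) x) := by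
    intro i
    by_cases hi : i ≤ n
    · obtain ⟨B, h1, h2, -, -, h3⟩ := (hseq i hi).exists_row
      exact ⟨B, fun _ => ⟨h1, h2, h3⟩⟩
    · exact ⟨fun _ => none, fun h => absurd h hi⟩
  choose B hB using hrows
  have hm : 0 < W := by omega
  obtain ⟨f, hf⟩ := exists_subtype_array (P := M.ValidCell) (n := n) hm
    (fun i x => ⟨i == 0, D i, T i x, T (i + 1) x, headAt (H i) (P i) x,
      headAt (H (i + 1)) (P (i + 1)) x, B i x, B i (x + 1)⟩) fun i hi x hx => by
      rw [ValidCell, ite_eq_entry, ite_eq_exit]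
      exact (hB i hi).2.2 x hx
  refine ⟨fun h => by rw [h] at hW; simp at hW; omega, f, ?_, ?_, ?_, ?_, ?_, ?_⟩
  · intro x hx
    rw [hW] at hx
    simp only [sweepDomino, hf 0 (Nat.zero_le _) x hx, hT0]
    exact ⟨rfl, inputTape_eq _⟩
  · intro i hi
    simp only [sweepDomino, hf i hi 0 hm]
    refine ⟨(hB i hi).1, fun h => ?_⟩
    obtain rfl : i = 0 := by simpa using h
    rw [hH0]
    rfl
  · intro i hi
    rw [hW]
    simp only [sweepDomino, hf i hi (W - 1) (by omega)]
    rw [Nat.sub_add_cancel hm]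
    exact (hB i hi).2.1
  · intro x hx
    rw [hW] at hx
    simp only [sweepDomino, hf n le_rfl x hx, hPn]
    intro q' hq'
    rw [headAt] at hq'
    split_ifs at hq' with hx'
    obtain rfl : q = q' := by simpa using hq'
    exact hc
  · intro i hi x hx
    rw [hW] at hx
    simp only [sweepDomino, hf i hi x (by omega), hf i hi (x + 1) hx, true_and]
    intro h
    obtain rfl : i = 0 := by simpa using h
    rw [hT0, hP0, hH0]
    constructor
    · intro hx'
      rcases x with _ | x
      · rfl
      · exact absurd hx' (inputTape_ne_leftEnd (by omega))
    · intro hx'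
      rcases x with _ | x
      · exact absurd rfl hx'
      · rw [headAt, if_neg (by omega)]
  · intro i hi x hx
    rw [hW] at hx
    simp only [sweepDomino, hf i hi.le x hx, hf (i + 1) hi x hx, and_self]

end LBM

/-! ### Folding of tapes -/

/-- The place on the tape of the cell in column `j` of the track `b`: after the left end marker,
the tape is cut into tracks of length `m`, which are read alternately from left to right and from
right to left. -/
def trackPos (m b j : ℕ) : ℕ := 1 + b * m + if b % 2 = 0 then j else m - 1 - j

theorem trackPos_lt {m b j e : ℕ} (hj : j < m) (hb : b < e + 1) :
    0 < trackPos m b j ∧ trackPos m b j + 1 < (e + 1) * m + 2 := by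
  have : (b + 1) * m ≤ (e + 1) * m := Nat.mul_le_mul_right m hb
  rw [add_mul, one_mul] at this
  rw [trackPos]
  split_ifs <;> omega

theorem exists_trackPos {m x e : ℕ} (hx0 : x ≠ 0) (hx : x < (e + 1) * m + 1) :
    ∃ b < e + 1, ∃ j < m, x = trackPos m b j := by
  have hm : 0 < m := by
    rcases Nat.eq_zero_or_pos m with rfl | h
    · simp at hx; omega
    · exact h
  have h1 := Nat.mod_add_div (x - 1) m
  have h2 := Nat.mod_lt (x - 1) hm
  have h3 : (x - 1) / m < e + 1 := (Nat.div_lt_iff_lt_mul hm).2 (by omega)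
  rw [mul_comm] at h1
  by_cases hb : (x - 1) / m % 2 = 0
  · refine ⟨_, h3, (x - 1) % m, h2, ?_⟩
    rw [trackPos, if_pos hb]
    omega
  · refine ⟨_, h3, m - 1 - (x - 1) % m, by omega, ?_⟩
    rw [trackPos, if_neg hb]
    omega

theorem trackPos_inj {m b j b' j' : ℕ} (hj : j < m) (hj' : j' < m)
    (h : trackPos m b j = trackPos m b' j') : b = b' ∧ j = j' := by
  have key : ∀ r r', r < m → r' < m → 1 + b * m + r = 1 + b' * m + r' → b = b' ∧ r = r' := by
    intro r r' hr hr' h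
    have hb : b = b' := by
      have h1 : (r + b * m) / m = (r' + b' * m) / m := by congr 1; omega
      rwa [Nat.add_mul_div_right _ _ (by omega), Nat.add_mul_div_right _ _ (by omega),
        Nat.div_eq_of_lt hr, Nat.div_eq_of_lt hr', zero_add, zero_add] at h1
    subst hb
    exact ⟨rfl, by omega⟩
  obtain ⟨rfl, h⟩ := key _ _ (by split_ifs <;> omega) (by split_ifs <;> omega) h
  split_ifs at h <;> exact ⟨rfl, by omega⟩

/-- The word `w`, followed by `e * |w|` copies of `bl`, between `l` and `r`. -/
def tapeWord {A B : Type*} (l bl r : B) (g : A → B) (e : ℕ) (w : List A) : List B :=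
  l :: (w.map g ++ List.replicate (e * w.length) bl) ++ [r]

section

variable {A B : Type*} {l bl r : B} {g : A → B} {e : ℕ} {w : List A}

theorem tapeWord_length : (tapeWord l bl r g e w).length = (e + 1) * w.length + 2 := by
  simp [tapeWord]
  ring

theorem tapeWord_last {h} : (tapeWord l bl r g e w)[(e + 1) * w.length + 1]'h = r := by
  have : (e + 1) * w.length + 1 =
      (l :: (w.map g ++ List.replicate (e * w.length) bl)).length := by
    simp; ring
  simp only [tapeWord, this, List.getElem_concat_length]

theorem tapeWord_track_zero {j : ℕ} (hj : j < w.length) {h} :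
    (tapeWord l bl r g e w)[trackPos w.length 0 j]'h = g w[j] := by
  have : trackPos w.length 0 j = j + 1 := by simp [trackPos, add_comm]
  simp only [tapeWord, this, List.cons_append, List.getElem_cons_succ]
  rw [List.getElem_append_left (by simp; omega), List.getElem_append_left (by simpa using hj)]
  simp

theorem tapeWord_track {b j : ℕ} (hj : j < w.length) (hb0 : b ≠ 0) (hb : b < e + 1) {h} :
    (tapeWord l bl r g e w)[trackPos w.length b j]'h = bl := by
  obtain ⟨x, hx, hx1, hx2⟩ : ∃ x, trackPos w.length b j = x + 1 ∧ w.length ≤ x ∧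
      x < (e + 1) * w.length := by
    have h1 := trackPos_lt hj hb
    have h2 : 1 * w.length ≤ b * w.length := Nat.mul_le_mul_right _ (Nat.pos_of_ne_zero hb0)
    refine ⟨trackPos w.length b j - 1, by omega, ?_, by omega⟩
    rw [trackPos]
    omega
  rw [add_mul, one_mul] at hx2
  simp only [tapeWord, hx, List.cons_append, List.getElem_cons_succ]
  rw [List.getElem_append_left (by simp; omega), List.getElem_append_right (by simpa using hx1)]
  simp

end

/-! ### Folding of pictures into tracks -/

namespace DominoSystem

variable {A B : Type*} (D : DominoSystem B)

/-- The domino system whose pictures are those of `D` below a word `tapeWord l bl r g e w`, folded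
into `e + 1` tracks. -/
def fold (l bl r : B) (g : A → B) (e : ℕ) : DominoSystem A where
  Symbol := (Fin (e + 1) → D.Symbol) × D.Symbol × D.Symbol
  finite_symbol := by
    have := D.finite_symbol
    infer_instance
  top a s := D.top (g a) (s.1 0) ∧ (∀ b, b ≠ 0 → D.top bl (s.1 b)) ∧ D.top l s.2.1 ∧ D.top r s.2.2
  left s := D.left s.2.1 ∧ D.hor s.2.1 (s.1 0) ∧
    (∀ b : Fin e, b.val % 2 ≠ 0 → D.hor (s.1 b.castSucc) (s.1 b.succ)) ∧
    (e % 2 ≠ 0 → D.hor (s.1 (Fin.last e)) s.2.2 ∧ D.right s.2.2)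
  right s := (∀ b : Fin e, b.val % 2 = 0 → D.hor (s.1 b.castSucc) (s.1 b.succ)) ∧
    (e % 2 = 0 → D.hor (s.1 (Fin.last e)) s.2.2 ∧ D.right s.2.2)
  bot s := (∀ b, D.bot (s.1 b)) ∧ D.bot s.2.1 ∧ D.bot s.2.2
  hor s t := (∀ b, (b.val % 2 = 0 → D.hor (s.1 b) (t.1 b)) ∧
    (b.val % 2 ≠ 0 → D.hor (t.1 b) (s.1 b)))
  ver s t := (∀ b, D.ver (s.1 b) (t.1 b)) ∧ D.ver s.2.1 t.2.1 ∧ D.ver s.2.2 t.2.2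

variable {D} {l bl r : B} {g : A → B} {e : ℕ}

/-- In the zigzag, consecutive tape cells lie in adjacent columns of a track, or in one column when
the track changes, so all horizontal conditions remain local. Both end markers are copied into every
column. -/
theorem Accepts.fold {w : List A} {n : ℕ} (hw : w ≠ [])
    (h : D.Accepts (tapeWord l bl r g e w) n) : (D.fold l bl r g e).Accepts w n := by
  obtain ⟨-, f, hf⟩ := h
  have hm : 0 < w.length := List.length_pos_iff.2 hw
  generalize hmm : w.length = m at hm
  have hlen : (tapeWord l bl r g e w).length = (e + 1) * m + 2 := by
    rw [tapeWord_length, hmm]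
  have hpos : ∀ {b j}, j < m → b < e + 1 →
      0 < trackPos m b j ∧ trackPos m b j + 1 < (tapeWord l bl r g e w).length := by
    intro b j hj hb
    rw [hlen]
    exact trackPos_lt hj hb
  have hor : ∀ i ≤ n, ∀ x y, x + 1 = y → y < (e + 1) * m + 2 → D.hor (f i x) (f i y) := by
    rintro i hi x _ rfl hy
    exact hf.hor i hi x (by rwa [hlen])
  have hlast : ∀ i ≤ n, ∀ j, (j = if e % 2 = 0 then m - 1 else 0) →
      D.hor (f i (trackPos m e j)) (f i ((e + 1) * m + 1)) ∧ D.right (f i ((e + 1) * m + 1)) := by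
    intro i hi j hj
    refine ⟨hor i hi _ _ ?_ (by omega), ?_⟩
    · rw [trackPos, add_mul, one_mul]
      split_ifs at hj ⊢ <;> omega
    · have := hf.right i hi
      rwa [hlen] at this
  -- Tracks `b` and `b + 1` meet in the last column for even `b` and in the first for odd `b`, where
  -- `right` and `left` can test them inside one symbol.
  have hturn : ∀ i ≤ n, ∀ b < e, ∀ j, (j = if b % 2 = 0 then m - 1 else 0) →
      D.hor (f i (trackPos m b j)) (f i (trackPos m (b + 1) j)) := by
    intro i hi b hb j hj
    have hjm : j < m := by split_ifs at hj <;> omega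
    refine hor i hi _ _ ?_ (by have := trackPos_lt hjm (show b + 1 < e + 1 by omega); omega)
    rw [trackPos, trackPos, add_mul, one_mul]
    split_ifs at hj ⊢ <;> omega
  refine ⟨hw, fun i j => (fun b => f i (trackPos m b j), f i 0, f i ((e + 1) * m + 1)),
    ?_, ?_, ?_, ?_, ?_, ?_⟩
  · intro j hj
    have hj' : j < m := by omega
    refine ⟨?_, fun b hb => ?_, ?_, ?_⟩
    · have := hf.top (trackPos m 0 j) (by have := hpos hj' (Nat.zero_lt_succ e); omega)
      subst hmm
      rwa [tapeWord_track_zero hj] at this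
    · have := hf.top (trackPos m b j) (by have := hpos hj' b.2; omega)
      subst hmm
      rwa [tapeWord_track hj (fun h => hb (Fin.ext h)) b.2] at this
    · exact hf.top 0 (by omega)
    · have := hf.top ((e + 1) * m + 1) (by omega)
      subst hmm
      rwa [tapeWord_last] at this
  · intro i hi
    refine ⟨hf.left i hi, hor i hi _ _ ?_ ?_, fun b hb => ?_, fun he => ?_⟩
    · simp [trackPos]
    · have := trackPos_lt hm (Nat.zero_lt_succ e)
      exact Nat.lt_of_succ_lt this.2
    · exact hturn i hi b b.2 0 (by rw [if_neg hb])
    · exact hlast i hi 0 (by rw [if_neg he])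
  · intro i hi
    rw [hmm]
    refine ⟨fun b hb => ?_, fun he => ?_⟩
    · exact hturn i hi b b.2 (m - 1) (by rw [if_pos hb])
    · exact hlast i hi (m - 1) (by rw [if_pos he])
  · intro j hj
    exact ⟨fun b => hf.bot _ (by have := hpos (show j < m by omega) b.2; omega),
      hf.bot _ (by omega), hf.bot _ (by omega)⟩
  · intro i hi j hj b
    have hj' : j + 1 < m := by omega
    constructor <;> intro hb
    · refine hor i hi _ _ ?_ (by have := trackPos_lt hj' b.2; omega)
      rw [trackPos, trackPos, if_pos hb, if_pos hb]
      omega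
    · refine hor i hi _ _ ?_ (by have := trackPos_lt (Nat.lt_of_succ_lt hj') b.2; omega)
      rw [trackPos, trackPos, if_neg hb, if_neg hb]
      omega
  · intro i hi j hj
    exact ⟨fun b => hf.ver i hi _ (by have := hpos (show j < m by omega) b.2; omega),
      hf.ver i hi _ (by omega), hf.ver i hi _ (by omega)⟩

/-- Of the copies of the markers, only that of the left one in column `0` and that of the right one
in the column `c` where the last track ends are used. -/
theorem accepts_of_fold {w : List A} {n : ℕ} (h : (D.fold l bl r g e).Accepts w n) :
    D.Accepts (tapeWord l bl r g e w) n := by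
  classical
  obtain ⟨hw, f, hf⟩ := h
  have hm : 0 < w.length := List.length_pos_iff.2 hw
  obtain ⟨m, hmm⟩ : ∃ m, w.length = m := ⟨_, rfl⟩
  rw [hmm] at hm
  have hlen : (tapeWord l bl r g e w).length = (e + 1) * m + 2 := by
    rw [tapeWord_length, hmm]
  obtain ⟨c, hc⟩ : ∃ c, c = if e % 2 = 0 then m - 1 else 0 := ⟨_, rfl⟩
  have hcm : c < w.length := by split_ifs at hc <;> omega
  -- The three descriptions of the entry at `x` exclude each other, and by `trackPos_inj` the track
  -- and the column are determined by `x`.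
  have hF : ∀ i x, ∃ s, (x = 0 → s = (f i 0).2.1) ∧ (x = (e + 1) * m + 1 → s = (f i c).2.2) ∧
      ∀ (b : Fin (e + 1)) (j : ℕ), j < m → x = trackPos m b j → s = (f i j).1 b := by
    intro i x
    by_cases h0 : x = 0
    · refine ⟨(f i 0).2.1, fun _ => rfl, fun h => by omega, fun b j hj hx => ?_⟩
      have := trackPos_lt hj b.2
      omega
    · by_cases h1 : x = (e + 1) * m + 1
      · refine ⟨(f i c).2.2, fun h => absurd h h0, fun _ => rfl, fun b j hj hx => ?_⟩
        have := trackPos_lt hj b.2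
        omega
      · by_cases h2 : ∃ b : Fin (e + 1), ∃ j < m, x = trackPos m b j
        · obtain ⟨b, j, hj, hx⟩ := h2
          refine ⟨(f i j).1 b, fun h => absurd h h0, fun h => absurd h h1, fun b' j' hj' hx' => ?_⟩
          obtain ⟨hb, rfl⟩ := trackPos_inj hj hj' (hx.symm.trans hx')
          rw [Fin.ext hb]
        · exact ⟨(f i 0).2.1, fun h => absurd h h0, fun h => absurd h h1,
            fun b j hj hx => absurd ⟨b, j, hj, hx⟩ h2⟩
  choose F hF0 hF1 hFt using hF
  replace hF0 : ∀ i, F i 0 = (f i 0).2.1 := fun i => hF0 i 0 rfl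
  replace hF1 : ∀ i, F i ((e + 1) * m + 1) = (f i c).2.2 := fun i => hF1 i _ rfl
  replace hFt : ∀ i (b : Fin (e + 1)) (j : ℕ), j < m → F i (trackPos m b j) = (f i j).1 b :=
    fun i b j hj => hFt i _ b j hj rfl
  have hcases : ∀ x < (e + 1) * m + 2, x = 0 ∨ x = (e + 1) * m + 1 ∨
      ∃ b : Fin (e + 1), ∃ j < m, x = trackPos m b j := by
    intro x hx
    by_cases h0 : x = 0
    · exact .inl h0
    · by_cases h1 : x = (e + 1) * m + 1
      · exact .inr (.inl h1)
      · obtain ⟨b, hb, j, hj, h⟩ := exists_trackPos (m := m) (e := e) h0 (by omega)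
        exact .inr (.inr ⟨⟨b, hb⟩, j, hj, h⟩)
  have hlast : ∀ i ≤ n, D.hor ((f i c).1 (Fin.last e)) (f i c).2.2 ∧ D.right (f i c).2.2 := by
    intro i hi
    split_ifs at hc with he
    · have := (hf.right i hi).2 he
      rwa [hmm, ← hc] at this
    · have := (hf.left i hi).2.2.2 he
      rwa [← hc] at this
  refine ⟨List.cons_ne_nil _ _, F, ?_, ?_, ?_, ?_, ?_, ?_⟩
  · intro x hx
    rcases hcases x (by omega) with rfl | rfl | ⟨b, j, hj, rfl⟩
    · rw [hF0]
      exact (hf.top 0 (by omega)).2.2.1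
    · rw [hF1]
      have := (hf.top c hcm).2.2.2
      subst hmm
      rwa [tapeWord_last]
    · rw [hFt 0 b j hj]
      have := hf.top j (by omega)
      subst hmm
      by_cases hb : b = 0
      · subst hb
        have h0 : (tapeWord l bl r g e w)[trackPos w.length (0 : Fin (e + 1)) j] = g w[j] :=
          tapeWord_track_zero hj
        rw [h0]
        exact this.1
      · rw [tapeWord_track hj (fun h => hb (Fin.ext h)) b.2]
        exact this.2.1 b hb
  · intro i hi
    rw [hF0]
    exact (hf.left i hi).1
  · intro i hi
    rw [hlen, show (e + 1) * m + 2 - 1 = (e + 1) * m + 1 by omega, hF1]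
    exact (hlast i hi).2
  · intro x hx
    rcases hcases x (by omega) with rfl | rfl | ⟨b, j, hj, rfl⟩
    · rw [hF0]
      exact (hf.bot 0 (by omega)).2.1
    · rw [hF1]
      exact (hf.bot c hcm).2.2
    · rw [hFt _ b j hj]
      exact (hf.bot j (by omega)).1 b
  · intro i hi x hx
    rcases hcases x (by omega) with rfl | rfl | ⟨b, j, hj, rfl⟩
    · have : 0 + 1 = trackPos m (0 : Fin (e + 1)) 0 := by simp [trackPos]
      rw [hF0, this, hFt i 0 0 hm]
      exact (hf.left i hi).2.1
    · omega
    · rw [hFt i b j hj]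
      -- Either the next tape cell lies on the same track, or the track ends here; in the second
      -- case a turn or the right marker follows.
      by_cases hstep : if b.val % 2 = 0 then j + 1 < m else 0 < j
      · by_cases hb : b.val % 2 = 0
        · rw [if_pos hb] at hstep
          have : trackPos m b j + 1 = trackPos m b (j + 1) := by
            rw [trackPos, trackPos, if_pos hb, if_pos hb]
            omega
          rw [this, hFt i b _ hstep]
          exact (hf.hor i hi j (by omega) b).1 hb
        · rw [if_neg hb] at hstep
          obtain ⟨j, rfl⟩ : ∃ k, j = k + 1 := ⟨j - 1, by omega⟩
          have : trackPos m b (j + 1) + 1 = trackPos m b j := by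
            rw [trackPos, trackPos, if_neg hb, if_neg hb]
            omega
          rw [this, hFt i b _ (by omega)]
          exact (hf.hor i hi j (by omega) b).2 hb
      · have hj' : j = if b.val % 2 = 0 then m - 1 else 0 := by
          split_ifs at hstep ⊢ <;> omega
        by_cases hbe : b.val < e
        · obtain ⟨b', rfl⟩ : ∃ b' : Fin e, b = b'.castSucc := ⟨⟨b, hbe⟩, rfl⟩
          have : trackPos m b'.castSucc j + 1 = trackPos m b'.succ j := by
            rw [trackPos, trackPos, Fin.val_castSucc, Fin.val_succ, add_mul, one_mul]
            rw [Fin.val_castSucc] at hj'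
            split_ifs at hj' ⊢ <;> omega
          rw [this, hFt i _ j hj]
          rw [Fin.val_castSucc] at hj'
          split_ifs at hj' with hb
          · have := (hf.right i hi).1 b' hb
            rwa [hmm, ← hj'] at this
          · have := (hf.left i hi).2.2.1 b' hb
            rwa [← hj'] at this
        · obtain rfl : b = Fin.last e := Fin.ext (by have := b.2; simp; omega)
          rw [Fin.val_last, ← hc] at hj'
          subst hj'
          have : trackPos m (Fin.last e) j + 1 = (e + 1) * m + 1 := by
            rw [trackPos, Fin.val_last, add_mul, one_mul]
            split_ifs at hc ⊢ <;> omega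
          rw [this, hF1]
          exact (hlast i hi).1
  · intro i hi x hx
    rcases hcases x (by omega) with rfl | rfl | ⟨b, j, hj, rfl⟩
    · rw [hF0, hF0]
      exact (hf.ver i hi 0 (by omega)).2.1
    · rw [hF1, hF1]
      exact (hf.ver i hi c hcm).2.2
    · rw [hFt _ b j hj, hFt _ b j hj]
      exact (hf.ver i hi j (by omega)).1 b

end DominoSystem

theorem LBM.init_tape_eq_tapeWord {A : Type*} (M : LBM A) (w : List A) : (M.init w).tape =
    tapeWord .leftEnd (.letter M.blank) .rightEnd (fun a => .letter (M.input a)) M.extra w := by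
  simp [LBM.init, tapeWord]

/-- Folding changes the width but not the number of rows, so the constant `c` of the machine is
kept. -/
theorem AcceptedByLinearReversalLBM.acceptedByDominoes {A : Type*} {L : Language A}
    (hL : [] ∉ L) (h : AcceptedByLinearReversalLBM L) : AcceptedByDominoes L := by
  obtain ⟨M, c, hM, rfl⟩ := h
  refine ⟨M.sweepDomino.fold .leftEnd (.letter M.blank) .rightEnd (fun a => .letter (M.input a))
    M.extra, c, fun w n h => ?_, fun w hw => ?_⟩
  · have := DominoSystem.accepts_of_fold h
    rw [← M.init_tape_eq_tapeWord] at this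
    exact LBM.mem_language_of_sweepDomino this
  · obtain ⟨ds, hds, hr⟩ := hM w hw
    have h := hds.sweepDomino_accepts
    rw [M.init_tape_eq_tapeWord] at h
    exact ⟨_, hr, h.fold fun h => hL (h ▸ hw)⟩

end SyncGraph

theorem mainTheorem7 {A : Type*} [Finite A] (L : Language A) (hL : [] ∉ L) :
    (SyncGraph.AcceptedBySynchronizedGraph L ↔ SyncGraph.AcceptedByLinearReversalLBM L) ∧
    (SyncGraph.AcceptedBySynchronizedGraph L ↔ SyncGraph.AcceptedByLinearHeightTiling L) :=
  ⟨⟨fun h => (h.acceptedByDominoes hL).acceptedByLinearReversalLBM,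
    fun h => (h.acceptedByDominoes hL).acceptedBySynchronizedGraph⟩,
   ⟨fun h => (h.acceptedByDominoes hL).acceptedByLinearHeightTiling,
    fun h => h.acceptedByDominoes.acceptedBySynchronizedGraph⟩⟩
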